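/- Let $\mathbb H$ be the real quaternions. **Column determinants.** For a square quaternion matrix $M=(m_{pq})$ whose rows and columns are indexed by the same finite totally ordered set $S$, and $j\in S$, put $$\operatorname{cdet}_j M=\sum_{\sigma}\operatorname{sgn}(\sigma)\,W_{c}\cdots W_{2}W_{1},$$ the sum running over all permutations $\sigma$ of $S$. Here $s_1=j$, the elements $s_2<\dots<s_c$ are the minimal elements of the cycles of $\sigma$ (fixed points included) not containing $j$, and, for the cycle of length $l$ through $s_q$, $W_q=m_{s_q,\sigma^{l-1}s_q}\cdots m_{\sigma^2 s_q,\sigma s_q}\,m_{\sigma s_q,s_q}$. If $M$ is Hermitian, all $\operatorname{cdet}_jM$ coincide with one real number, denoted $|M|$; the empty matrix has $|M|=1$. **Notation.** For an $n\times n$ matrix $M$ and a set $\beta\subseteq\{1,\dots,n\}$, $M_\beta^\beta$ is the principal submatrix with rows and columns in $\beta$; $J_{r,n}$ is the collection of all $\beta$ with $r$ elements, and $J_{r,n}\{i\}$ the collection of those containing $i$; $M_{.i}(v)$ is $M$ with its $i$-th column replaced by the column $v$; $M^*$ is the conjugate transpose. The rank of a quaternion matrix is the dimension of the right $\mathbb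 H$-space spanned by its columns. **Theorem 3.16.** Let $A\in\mathbb H^{n\times n}$ have index $k$, i.e. $k$ is the smallest positive integer with $\operatorname{rank}A^{k+1}=\operatorname{rank}A^k$; let $r$ be this common rank, and let $b\in\mathbb H^{n\times 1}$ be constant. Then $A$ has a Drazin inverse, that is, there is a unique matrix $X=A^D$ with $XAX=X$, $AX=XA$, $A^{k+1}X=A^k$, and $$x(t)=-A^Db+\sum_{m=1}^{k}\frac1{m!}\left(A^{m-1}b-A^DA^mb\right)t^m\qquad(t\in\mathbb R)$$ is a solution of $x'=Ax+b$. Its entries $x_i(t)$, $i=1,\dots,n$, have for all $t\in\mathbb R$ the following representations, in which all denominators are nonzero. (i) If $A$ is Hermitian, put $\hat b^{(l)}=A^lb$, with entries $\hat b^{(l)}_i$. Then $$x_i(t)=-\frac{\sum_{\beta\in J_{r,n}\{i\}}\operatorname{cdet}_i\left(A^{k+1}_{.i}(\hat b^{(k)})\right)_\beta^\beta}{\sum_{\beta\in J_{r,n}}\left|(A^{k+1})_\beta^\beta\right|} +\sum_{m=1}^{k}\frac{1}{m!}\left(\hat b^{(m-1)}_i-\frac{\sum_{\beta\in J_{r,n}\{i\}}\operatorname{cdet}_i\left(A^{k+1}_{.i}(\hat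 b^{(k+m)})\right)_\beta^\beta}{\sum_{\beta\in J_{r,n}}\left|(A^{k+1})_\beta^\beta\right|}\right)t^m .$$ (ii) If $A$ is arbitrary, put $H=(A^{2k+1})^*A^{2k+1}$, $\hat d^{(l)}=(A^{2k+1})^*A^{k+l}b$ for $0\le l\le k$, $\hat b^{(l)}=A^lb$, and let $a^{(k)}_{is}$ be the entries of $A^k$. Then $$x_i(t)=-\frac{\sum_{s=1}^n a^{(k)}_{is}\sum_{\beta\in J_{r,n}\{s\}}\operatorname{cdet}_s\left(H_{.s}(\hat d^{(0)})\right)_\beta^\beta}{\sum_{\beta\in J_{r,n}}|H_\beta^\beta|} +\sum_{m=1}^{k}\frac{1}{m!}\left(\hat b^{(m-1)}_i-\frac{\sum_{s=1}^n a^{(k)}_{is}\sum_{\beta\in J_{r,n}\{s\}}\operatorname{cdet}_s\left(H_{.s}(\hat d^{(m)})\right)_\beta^\beta}{\sum_{\beta\in J_{r,n}}|H_\beta^\beta|}\right)t^m .$$ -/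

import Mathlib

open scoped Quaternion Matrix

namespace QuatLin

noncomputable section

/-- The ordered product attached to the cycle of `σ` through `s`, of length `m`:
`a_{s, σ^(m-1) s} ⋯ a_{σ² s, σ s} a_{σ s, s}`, so that the column index of the rightmost factor
is `s`. For a fixed point this is `a_{s s}`. -/
def cycleProd {ι : Type*} (A : Matrix ι ι ℍ[ℝ]) (σ : Equiv.Perm ι) (s : ι) : ℍ[ℝ] :=
  ((List.range (Function.minimalPeriod σ s)).reverse.map
    fun p => A ((σ ^ (p + 1)) s) ((σ ^ p) s)).prod

open Classical in
/-- The minimal elements of the cycles of `σ` (fixed points included) that do not contain `j`,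
listed in increasing order. -/
def otherBases {ι : Type*} [Fintype ι] [LinearOrder ι] (σ : Equiv.Perm ι) (j : ι) : List ι :=
  (Finset.univ.filter fun s => ¬ σ.SameCycle j s ∧ ∀ s', σ.SameCycle s s' → s ≤ s').sort (· ≤ ·)

/-- The `j`-th column determinant of a square quaternion matrix. In each monomial the product over
the cycle containing `j` stands rightmost and begins (from the right) at `j`; the other cycles
begin at their minimal elements and are placed from right to left by increasing minimal element.
The sign `(-1)^(n - number of cycles)` is the sign of the permutation. -/
def cdet {ι : Type*} [Fintype ι] [LinearOrder ι] (A : Matrix ι ι ℍ[ℝ]) (j : ι) : ℍ[ℝ] :=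
  ∑ σ : Equiv.Perm ι,
    ((Equiv.Perm.sign σ : ℤ) : ℍ[ℝ]) *
      ((j :: otherBases σ j).reverse.map (cycleProd A σ)).prod

open Classical in
/-- The determinant of a Hermitian quaternion matrix. All its column determinants coincide, and
their common value is taken here at the first index; the determinant of the empty matrix is `1`.
(It is only used for Hermitian matrices.) -/
def hermDet {ι : Type*} [Fintype ι] [LinearOrder ι] (A : Matrix ι ι ℍ[ℝ]) : ℍ[ℝ] :=
  if h : (Finset.univ : Finset ι).Nonempty then cdet A (Finset.univ.min' h) else 1

/-- The principal submatrix with rows and columns indexed by `β`. -/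
def principal {n : ℕ} (A : Matrix (Fin n) (Fin n) ℍ[ℝ]) (β : Finset (Fin n)) :
    Matrix {x // x ∈ β} {x // x ∈ β} ℍ[ℝ] :=
  A.submatrix (fun x => (x : Fin n)) (fun x => (x : Fin n))

/-- The sum of the principal minors of order `r` of a Hermitian matrix `H`. -/
def minorSum {n : ℕ} (r : ℕ) (H : Matrix (Fin n) (Fin n) ℍ[ℝ]) : ℍ[ℝ] :=
  ∑ β : {β : Finset (Fin n) // β.card = r}, hermDet (principal H β.1)

/-- The sum, over the sets `β` of `r` indices with `i ∈ β`, of the column determinants `cdet_i` of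
the principal submatrices on `β` of the matrix obtained from `H` by replacing its `i`-th column
with `v`. -/
def cdetSum {n : ℕ} (r : ℕ) (H : Matrix (Fin n) (Fin n) ℍ[ℝ]) (i : Fin n) (v : Fin n → ℍ[ℝ]) :
    ℍ[ℝ] :=
  ∑ β : {β : Finset (Fin n) // β.card = r ∧ i ∈ β},
    cdet (principal (H.updateCol i v) β.1) ⟨i, β.2.2⟩

/-- The rank of a quaternion matrix: the dimension of the right vector space spanned by its
columns. -/
def qrank {n : ℕ} (A : Matrix (Fin n) (Fin n) ℍ[ℝ]) : ℕ :=
  Module.finrank ℍ[ℝ]ᵐᵒᵖ (Submodule.span ℍ[ℝ]ᵐᵒᵖ (Set.range A.col))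

/-- `k` is the index of `A`: the smallest positive integer with `rank A^(k+1) = rank A^k`. -/
def HasIndex {n : ℕ} (A : Matrix (Fin n) (Fin n) ℍ[ℝ]) (k : ℕ) : Prop :=
  IsLeast {m : ℕ | 0 < m ∧ qrank (A ^ (m + 1)) = qrank (A ^ m)} k

/-- The equations that define the Drazin inverse `X` of a matrix `A` of index `k`. -/
def IsDrazinInverse {n : ℕ} (A : Matrix (Fin n) (Fin n) ℍ[ℝ]) (k : ℕ)
    (X : Matrix (Fin n) (Fin n) ℍ[ℝ]) : Prop :=
  X * A * X = X ∧ A * X = X * A ∧ A ^ (k + 1) * X = A ^ k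

/-- `x(t) = -D b + ∑_{m=1}^k (1/m!) (A^(m-1) b - D A^m b) t^m`; here `D` is the Drazin inverse
of `A`. -/
def partialSol {n : ℕ} (A D : Matrix (Fin n) (Fin n) ℍ[ℝ]) (b : Fin n → ℍ[ℝ]) (k : ℕ) (t : ℝ) :
    Fin n → ℍ[ℝ] :=
  -(D *ᵥ b) + ∑ m ∈ Finset.Icc 1 k,
    (t ^ m / (m.factorial : ℝ)) • ((A ^ (m - 1)) *ᵥ b - (D * A ^ m) *ᵥ b)

end

end QuatLin

open QuatLin

/-!
The proof rests on the adjugate identity for a Hermitian quaternion matrix `H`: replacing the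
`j`-th column in the column determinant `cdet_j` by the `m`-th column gives `δ_{jm} |H|`.

Fix a set `S` of indices and sum over the permutations of `S`. Splitting such a sum according to the
image `a` of `j` (`sum_permsOn`) expands a column determinant along the rightmost factor of its
monomials, in terms of `S \ {a}` (`pointedSum_eq`). The same expansion holds when the product of the
cycles avoiding `j` is replaced by the product of the real parts of these cycles. For these
commutative sums the expansion along the rightmost factor implies one along the leftmost factor
(`pointedSum_realWeight_eq_left`), and the two together give by induction on `S` that the adjugate
of `H` is Hermitian (`star_adjEntry`) and that the adjugate identity holds
(`pointedSum_realWeight_self`, `pointedSum_realWeight_other`). Since both kinds of sums obey the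
same expansion, they agree for Hermitian matrices (`permSum_orderedWeight`); in particular all
column determinants of `H` coincide and are real.

Let `C_l` be the sum of the adjugates of the principal submatrices of order `l`, and `d_l` the sum of
the principal minors of order `l`. The adjugate identity yields the Faddeev–LeVerrier recursion
`C_{l+1} = d_l - C_l H` (`adjSum_succ`) and `tr (C_l H) = l d_l` (`trace_adjSum_mul`). Let `s` be the
largest order with `d_s ≠ 0`. The recursion ends with zero, so `C_{s+1}` is annihilated by a power of
`H`, hence by `H`, which is Hermitian. Thus `P = d_s⁻¹ C_s H` is an idempotent with the same column
space as `H`, and its trace `s` is the rank of `H`. So for `r = rank H` we have `d_r ≠ 0` and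
`C_r H² = d_r H` (`adjSum_qrank`).

The Drazin inverse `D` of `A` is `V A^(2k+1) U` with `A^k = A^(2k+1) U = V A^(2k+1)`. Its
representation by determinants follows from `C_r H² = d_r H` for `H = A^(k+1)` when `A` is Hermitian,
and for `H = Bᴴ B` with `B = A^(2k+1)` in general, where `C_r Bᴴ / d_r` is a generalized inverse
of `B`. That the polynomial in `t` solves the differential equation is a direct computation, in which
the sum telescopes because `D A^(k+1) = A^k`.
-/

set_option linter.unusedSectionVars false

namespace QuatLin

/-! ### Permutations of a subset and their cycles -/

section Perm

variable {ι : Type*} [Fintype ι] [LinearOrder ι]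

/-- The permutations of `ι` that fix every point outside `S`. -/
def permsOn (S : Finset ι) : Finset (Equiv.Perm ι) :=
  Finset.univ.filter fun σ => ∀ x, x ∉ S → σ x = x

open Classical in
/-- The elements of `S` that are minimal in their `σ`-cycle. -/
noncomputable def cycleMins (σ : Equiv.Perm ι) (S : Finset ι) : Finset ι :=
  S.filter fun s => ∀ s', σ.SameCycle s s' → s ≤ s'

open Classical in
/-- The elements of `S` that are minimal in their `σ`-cycle, the cycle of `j` being left out. -/
noncomputable def otherMins (σ : Equiv.Perm ι) (S : Finset ι) (j : ι) : Finset ι :=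
  S.filter fun s => ¬ σ.SameCycle j s ∧ ∀ s', σ.SameCycle s s' → s ≤ s'

theorem mem_permsOn {S : Finset ι} {σ : Equiv.Perm ι} :
    σ ∈ permsOn S ↔ ∀ x, x ∉ S → σ x = x := by
  simp [permsOn]

theorem permsOn_apply_mem {S : Finset ι} {σ : Equiv.Perm ι} (hσ : σ ∈ permsOn S) {x : ι}
    (hx : x ∈ S) : σ x ∈ S := by
  by_contra h
  have h1 := mem_permsOn.1 hσ _ h
  exact h (by rwa [σ.injective h1])

theorem sameCycle_mem {S : Finset ι} {σ : Equiv.Perm ι} (hσ : σ ∈ permsOn S) {x y : ι}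
    (hx : x ∈ S) (h : σ.SameCycle x y) : y ∈ S := by
  obtain ⟨i, rfl⟩ := h.exists_nat_pow_eq
  induction i with
  | zero => simpa using hx
  | succ i ih =>
    rw [pow_succ', Equiv.Perm.mul_apply]
    exact permsOn_apply_mem hσ (ih ⟨i, by simp⟩)

theorem sameCycle_iff_nat {σ : Equiv.Perm ι} {x y : ι} :
    σ.SameCycle x y ↔ ∃ i : ℕ, (σ ^ i) x = y :=
  ⟨fun h => h.exists_nat_pow_eq, fun ⟨i, h⟩ => ⟨i, by simpa using h⟩⟩

theorem isPeriodicPt_perm {σ : Equiv.Perm ι} {n : ℕ} {x : ι} :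
    Function.IsPeriodicPt σ n x ↔ (σ ^ n) x = x := by
  rw [Function.IsPeriodicPt, Function.IsFixedPt, Equiv.Perm.iterate_eq_pow]

theorem perm_pow_minimalPeriod (σ : Equiv.Perm ι) (x : ι) :
    (σ ^ Function.minimalPeriod σ x) x = x :=
  isPeriodicPt_perm.1 (Function.isPeriodicPt_minimalPeriod σ x)

theorem perm_minimalPeriod_pos (σ : Equiv.Perm ι) (x : ι) : 0 < Function.minimalPeriod σ x := by
  apply Function.minimalPeriod_pos_of_mem_periodicPts
  exact ⟨orderOf σ, orderOf_pos σ, isPeriodicPt_perm.2 (by simp [pow_orderOf_eq_one])⟩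

theorem perm_pow_ne {σ : Equiv.Perm ι} {x : ι} {p : ℕ} (h0 : p ≠ 0)
    (hp : p < Function.minimalPeriod σ x) : (σ ^ p) x ≠ x := fun h =>
  Function.not_isPeriodicPt_of_pos_of_lt_minimalPeriod h0 hp (isPeriodicPt_perm.2 h)

/-- Two permutations with the same powers at `s` have the same cycle products at `s`, provided
that the matrices agree in the columns met by the cycle. -/
theorem cycleProd_congr {A B : Matrix ι ι ℍ[ℝ]} {σ τ : Equiv.Perm ι} {s : ι}
    (h : ∀ n : ℕ, (σ ^ n) s = (τ ^ n) s) (hAB : ∀ n : ℕ, ∀ x, A x ((σ ^ n) s) = B x ((σ ^ n) s)) :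
    cycleProd A σ s = cycleProd B τ s := by
  have hp : Function.minimalPeriod σ s = Function.minimalPeriod τ s := by
    rw [Function.minimalPeriod_eq_minimalPeriod_iff]
    intro n
    rw [isPeriodicPt_perm, isPeriodicPt_perm, h]
  unfold cycleProd
  rw [hp]
  congr 1
  apply List.map_congr_left
  intro p _
  rw [hAB, h, h]

theorem pow_apply_eq_of_agree {σ τ : Equiv.Perm ι} {s : ι}
    (h : ∀ n : ℕ, σ ((σ ^ n) s) = τ ((σ ^ n) s)) (n : ℕ) : (σ ^ n) s = (τ ^ n) s := by
  induction n with
  | zero => rfl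
  | succ n ih => rw [pow_succ', pow_succ', Equiv.Perm.mul_apply, Equiv.Perm.mul_apply, h, ih]

theorem sameCycle_congr {σ τ : Equiv.Perm ι} {s : ι} (h : ∀ n : ℕ, (σ ^ n) s = (τ ^ n) s)
    (y : ι) : σ.SameCycle s y ↔ τ.SameCycle s y := by
  simp only [sameCycle_iff_nat, h]

/-- If `τ` fixes `a`, then inserting `a` after `j` does not change the `τ`-orbits that avoid
`j` and `a`. -/
theorem pow_mul_swap_apply {τ : Equiv.Perm ι} {j a s : ι} (ha : τ a = a) (hsa : s ≠ a)
    (hs : ¬ τ.SameCycle j s) (n : ℕ) : ((τ * Equiv.swap j a) ^ n) s = (τ ^ n) s := by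
  symm
  apply pow_apply_eq_of_agree
  intro n
  have h1 : (τ ^ n) s ≠ j := fun h => hs (sameCycle_iff_nat.2 ⟨n, h⟩).symm
  have h2 : (τ ^ n) s ≠ a := fun h => by
    have h3 : (τ ^ n) a = a := Equiv.Perm.pow_apply_eq_self_of_apply_eq_self ha n
    exact hsa ((τ ^ n).injective (h.trans h3.symm))
  rw [Equiv.Perm.mul_apply, Equiv.swap_apply_of_ne_of_ne h1 h2]

theorem sameCycle_mul_swap {τ : Equiv.Perm ι} {j a s : ι} (ha : τ a = a) :
    (τ * Equiv.swap j a).SameCycle j s ↔ s = a ∨ τ.SameCycle j s := by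
  constructor
  · intro h
    by_contra hc
    push Not at hc
    obtain ⟨i, hi⟩ := sameCycle_iff_nat.1 h.symm
    rw [pow_mul_swap_apply ha hc.1 hc.2] at hi
    exact hc.2 (sameCycle_iff_nat.2 ⟨i, hi⟩).symm
  · have hja : (τ * Equiv.swap j a) j = a := by simp [ha]
    intro h
    by_cases hsa : s = a
    · exact ⟨1, by rw [zpow_one, hja, hsa]⟩
    · have h' := h.resolve_left hsa
      by_contra hc
      have hj : ∀ n : ℕ, ((τ * Equiv.swap j a) ^ n) s ≠ j := fun n hn =>
        hc (sameCycle_iff_nat.2 ⟨n, hn⟩).symm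
      have haa : ∀ n : ℕ, ((τ * Equiv.swap j a) ^ n) s ≠ a := fun n hn =>
        hc ((Equiv.Perm.SameCycle.trans (sameCycle_iff_nat.2 ⟨n, hn⟩)
          (Equiv.Perm.SameCycle.symm ⟨1, by rw [zpow_one, hja]⟩)).symm)
      have hp := pow_apply_eq_of_agree (σ := τ * Equiv.swap j a) (τ := τ) (s := s) (by
        intro n
        rw [Equiv.Perm.mul_apply, Equiv.swap_apply_of_ne_of_ne (hj n) (haa n)])
      obtain ⟨i, hi⟩ := sameCycle_iff_nat.1 h'.symm
      exact hj i ((hp i).trans hi)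

theorem otherMins_fixed {S : Finset ι} {σ : Equiv.Perm ι} {j : ι}
    (hσ : σ ∈ permsOn (S.erase j)) : otherMins σ S j = cycleMins σ (S.erase j) := by
  have hj : σ j = j := mem_permsOn.1 hσ j (by simp)
  have key : ∀ s, σ.SameCycle j s ↔ s = j := by
    intro s
    rw [sameCycle_iff_nat]
    constructor
    · rintro ⟨i, rfl⟩
      exact Equiv.Perm.pow_apply_eq_self_of_apply_eq_self hj i
    · rintro rfl
      exact ⟨0, rfl⟩
  ext s
  simp only [otherMins, cycleMins, Finset.mem_filter, Finset.mem_erase, key]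
  tauto

theorem otherMins_mul_swap {S : Finset ι} {τ : Equiv.Perm ι} {j a : ι}
    (hτ : τ ∈ permsOn (S.erase a)) :
    otherMins (τ * Equiv.swap j a) S j = otherMins τ (S.erase a) j := by
  have ha : τ a = a := mem_permsOn.1 hτ a (by simp)
  ext s
  simp only [otherMins, Finset.mem_filter, Finset.mem_erase, sameCycle_mul_swap ha]
  constructor
  · rintro ⟨h1, h2, h3⟩
    push Not at h2
    refine ⟨⟨h2.1, h1⟩, h2.2, fun s' hs' => h3 s' ?_⟩
    rwa [sameCycle_congr (pow_mul_swap_apply ha h2.1 h2.2)]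
  · rintro ⟨⟨h0, h1⟩, h2, h3⟩
    refine ⟨h1, by tauto, fun s' hs' => h3 s' ?_⟩
    rwa [sameCycle_congr (pow_mul_swap_apply ha h0 h2)] at hs'

theorem pow_succ_mul_swap_apply {τ : Equiv.Perm ι} {j a : ι} (ha : τ a = a) (hja : j ≠ a) {p : ℕ}
    (hp0 : 0 < p) (hp : p ≤ Function.minimalPeriod τ j) :
    ((τ * Equiv.swap j a) ^ (p + 1)) j = (τ ^ p) j := by
  induction p with
  | zero => omega
  | succ p ih =>
    rw [pow_succ', Equiv.Perm.mul_apply]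
    rcases Nat.eq_zero_or_pos p with h | h
    · subst h
      simp [ha]
    · rw [ih h (by omega), Equiv.Perm.mul_apply, Equiv.swap_apply_of_ne_of_ne, pow_succ' τ,
        Equiv.Perm.mul_apply]
      · exact perm_pow_ne (by omega) (by omega)
      · intro h3
        have h4 : (τ ^ p) a = a := Equiv.Perm.pow_apply_eq_self_of_apply_eq_self ha p
        exact hja ((τ ^ p).injective (h3.trans h4.symm))

theorem minimalPeriod_mul_swap {τ : Equiv.Perm ι} {j a : ι} (ha : τ a = a) (hja : j ≠ a) :
    Function.minimalPeriod (τ * Equiv.swap j a) j = Function.minimalPeriod τ j + 1 := by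
  have hpos := perm_minimalPeriod_pos τ j
  apply le_antisymm
  · apply Function.IsPeriodicPt.minimalPeriod_le (by omega)
    rw [isPeriodicPt_perm, pow_succ_mul_swap_apply ha hja hpos le_rfl, perm_pow_minimalPeriod]
  · by_contra hlt
    push Not at hlt
    have h1 := perm_pow_minimalPeriod (τ * Equiv.swap j a) j
    have h0 := perm_minimalPeriod_pos (τ * Equiv.swap j a) j
    generalize Function.minimalPeriod (τ * Equiv.swap j a) j = q at *
    obtain ⟨q, rfl⟩ : ∃ q', q = q' + 1 := ⟨q - 1, by omega⟩
    rcases Nat.eq_zero_or_pos q with h | h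
    · subst h
      simp [ha] at h1
      exact hja h1.symm
    · rw [pow_succ_mul_swap_apply ha hja h (by omega)] at h1
      exact perm_pow_ne (by omega) (by omega) h1

/-- Removing from the cycle of `j` the point `a` that follows `j`: the last factor of the cycle
product splits off, and the column `a` of the matrix takes the place of the column `j`. -/
theorem cycleProd_mul_swap (M : Matrix ι ι ℍ[ℝ]) (v : ι → ℍ[ℝ]) {τ : Equiv.Perm ι} {j a : ι}
    (ha : τ a = a) (hja : j ≠ a) :
    cycleProd (M.updateCol j v) (τ * Equiv.swap j a) j =
      cycleProd (M.updateCol j (M.col a)) τ j * v a := by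
  unfold cycleProd
  rw [minimalPeriod_mul_swap ha hja, List.range_succ_eq_map, List.reverse_cons, List.map_append,
    List.prod_append]
  congr 1
  · rw [← List.map_reverse, List.map_map]
    congr 1
    apply List.map_congr_left
    intro p hp
    simp only [List.mem_reverse, List.mem_range] at hp
    simp only [Function.comp, Nat.succ_eq_add_one]
    rw [pow_succ_mul_swap_apply ha hja (p := p + 1) (by omega) (by omega)]
    rcases Nat.eq_zero_or_pos p with h | h
    · subst h
      simp [ha, hja.symm]
    · have h1 : (τ ^ p) j ≠ j := perm_pow_ne (by omega) (by omega)
      rw [pow_succ_mul_swap_apply ha hja h (by omega), Matrix.updateCol_ne h1,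
        Matrix.updateCol_ne h1]
  · simp [ha]

theorem cycleProd_fixed (M : Matrix ι ι ℍ[ℝ]) {σ : Equiv.Perm ι} {j : ι} (h : σ j = j) :
    cycleProd M σ j = M j j := by
  have h1 : Function.minimalPeriod σ j = 1 := Function.minimalPeriod_eq_one_iff_isFixedPt.2 h
  simp [cycleProd, h1, h]

/-- The real part of a cycle product does not change when the cycle is rotated by one step. -/
theorem re_cycleProd_apply (M : Matrix ι ι ℍ[ℝ]) (σ : Equiv.Perm ι) (s : ι) :
    (cycleProd M σ (σ s)).re = (cycleProd M σ s).re := by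
  have hper : Function.minimalPeriod σ (σ s) = Function.minimalPeriod σ s :=
    Function.minimalPeriod_apply (Function.mem_periodicPts.2
      ⟨_, perm_minimalPeriod_pos σ s, Function.isPeriodicPt_minimalPeriod σ s⟩)
  have hl := perm_pow_minimalPeriod σ s
  unfold cycleProd
  rw [hper]
  obtain ⟨l, hl'⟩ : ∃ l, Function.minimalPeriod σ s = l + 1 :=
    ⟨_, (Nat.succ_pred_eq_of_pos (perm_minimalPeriod_pos σ s)).symm⟩
  rw [hl'] at hl ⊢
  rw [show ((List.range (l + 1)).reverse.map fun p => M ((σ ^ (p + 1)) s) ((σ ^ p) s)).prod =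
      ((List.range l).reverse.map fun p => M ((σ ^ (p + 1 + 1)) s) ((σ ^ (p + 1)) s)).prod *
        M (σ s) s by
      rw [List.range_succ_eq_map, List.reverse_cons, List.map_append, List.prod_append,
        ← List.map_reverse, List.map_map]
      simp [Function.comp_def],
    show ((List.range (l + 1)).reverse.map fun p =>
        M ((σ ^ (p + 1)) (σ s)) ((σ ^ p) (σ s))).prod =
      M ((σ ^ (l + 1)) (σ s)) ((σ ^ l) (σ s)) * ((List.range l).reverse.map fun p =>
        M ((σ ^ (p + 1)) (σ s)) ((σ ^ p) (σ s))).prod by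
      simp [List.range_succ]]
  have h1 : ∀ p : ℕ, (σ ^ p) (σ s) = (σ ^ (p + 1)) s := fun p => by
    rw [pow_succ, Equiv.Perm.mul_apply]
  have hc : ∀ x y : ℍ[ℝ], (x * y).re = (y * x).re := fun x y => by
    simp only [Quaternion.re_mul]; ring
  rw [hc]
  simp only [h1]
  rw [pow_succ' σ (l + 1), Equiv.Perm.mul_apply, hl]

theorem re_cycleProd_sameCycle (M : Matrix ι ι ℍ[ℝ]) {σ : Equiv.Perm ι} {s s' : ι}
    (h : σ.SameCycle s s') : (cycleProd M σ s').re = (cycleProd M σ s).re := by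
  obtain ⟨i, rfl⟩ := sameCycle_iff_nat.1 h
  induction i with
  | zero => rfl
  | succ i ih =>
    rw [pow_succ', Equiv.Perm.mul_apply, re_cycleProd_apply]
    exact ih ⟨i, by simp⟩

/-- The minimal elements of all cycles in `S` are those of the cycles that avoid `j`, together
with the minimal element of the cycle of `j`. -/
theorem exists_cycleMins_eq_insert {S : Finset ι} {σ : Equiv.Perm ι} {j : ι}
    (hσ : σ ∈ permsOn S) (hj : j ∈ S) :
    ∃ s, σ.SameCycle j s ∧ s ∉ otherMins σ S j ∧ cycleMins σ S = insert s (otherMins σ S j) := by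
  classical
  have hne : (S.filter fun s => σ.SameCycle j s).Nonempty :=
    ⟨j, by simp [hj, Equiv.Perm.SameCycle.refl]⟩
  have hmem := Finset.min'_mem _ hne
  set s := (S.filter fun s => σ.SameCycle j s).min' hne with hs
  simp only [Finset.mem_filter] at hmem
  have hmin : ∀ s', σ.SameCycle j s' → s ≤ s' := fun s' h' =>
    Finset.min'_le _ _ (by simp [h', sameCycle_mem hσ hj h'])
  refine ⟨s, hmem.2, by simp [otherMins, hmem.2], ?_⟩
  ext x
  simp only [cycleMins, otherMins, Finset.mem_filter, Finset.mem_insert]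
  constructor
  · rintro ⟨h1, h2⟩
    by_cases h : σ.SameCycle j x
    · exact Or.inl (le_antisymm (h2 _ (h.symm.trans hmem.2)) (hmin _ h))
    · exact Or.inr ⟨h1, h, h2⟩
  · rintro (rfl | ⟨h1, -, h2⟩)
    · exact ⟨hmem.1, fun s' h' => hmin s' (hmem.2.trans h')⟩
    · exact ⟨h1, h2⟩

theorem cycleMins_eq_insert_min {S : Finset ι} {σ : Equiv.Perm ι} {j : ι}
    (hσ : σ ∈ permsOn S) (hj : j ∈ S) (hmin : ∀ x ∈ S, j ≤ x) :
    j ∉ otherMins σ S j ∧ cycleMins σ S = insert j (otherMins σ S j) := by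
  obtain ⟨s, h1, h2, h3⟩ := exists_cycleMins_eq_insert hσ hj
  have hs : s ∈ cycleMins σ S := by simp [h3]
  simp only [cycleMins, Finset.mem_filter] at hs
  have : s = j := le_antisymm (hs.2 j h1.symm) (hmin s hs.1)
  subst this
  exact ⟨h2, h3⟩

/-- The sum over the permutations of `S`, split according to the image `a` of `j`. A permutation
with `j ↦ a` is a permutation of `S \ {a}` with `a` inserted after `j`. -/
theorem sum_permsOn {R : Type*} [AddCommMonoid R] {S : Finset ι} {j : ι} (hj : j ∈ S)
    (f : Equiv.Perm ι → R) :
    ∑ σ ∈ permsOn S, f σ =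
      ∑ a ∈ S, ∑ τ ∈ permsOn (S.erase a), f (τ * Equiv.swap j a) := by
  rw [← Finset.sum_fiberwise_of_maps_to (t := S) (g := fun σ : Equiv.Perm ι => σ j)
    (fun σ hσ => permsOn_apply_mem hσ hj)]
  refine Finset.sum_congr rfl fun a ha => ?_
  refine Finset.sum_nbij' (fun σ => σ * Equiv.swap j a) (fun τ => τ * Equiv.swap j a) ?_ ?_ ?_ ?_ ?_
  · intro σ hσ
    rw [Finset.mem_filter, mem_permsOn] at hσ
    rw [mem_permsOn]
    intro x hx
    rw [Equiv.Perm.mul_apply]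
    by_cases hxa : x = a
    · subst hxa; simp [hσ.2]
    · have hxS : x ∉ S := fun h => hx (by simp [hxa, h])
      have hxj : x ≠ j := fun h => hxS (h ▸ hj)
      rw [Equiv.swap_apply_of_ne_of_ne hxj hxa, hσ.1 x hxS]
  · intro τ hτ
    have hτa : τ a = a := mem_permsOn.1 hτ a (by simp)
    rw [Finset.mem_filter, mem_permsOn]
    refine ⟨fun x hx => ?_, by simp [hτa]⟩
    have hxj : x ≠ j := fun h => hx (h ▸ hj)
    have hxa : x ≠ a := fun h => hx (h ▸ ha)
    rw [Equiv.Perm.mul_apply, Equiv.swap_apply_of_ne_of_ne hxj hxa]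
    exact mem_permsOn.1 hτ x (by simp [hx])
  · intro σ _
    simp [mul_assoc]
  · intro σ _
    simp [mul_assoc]
  · intro σ _
    simp [mul_assoc]

end Perm

theorem quaternion_coe_sum {κ : Type*} (s : Finset κ) (f : κ → ℝ) :
    ((∑ x ∈ s, f x : ℝ) : ℍ[ℝ]) = ∑ x ∈ s, (f x : ℍ[ℝ]) :=
  map_sum (algebraMap ℝ ℍ[ℝ]) f s

theorem quaternion_re_sum {κ : Type*} (s : Finset κ) (f : κ → ℍ[ℝ]) :
    (∑ x ∈ s, f x).re = ∑ x ∈ s, (f x).re := by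
  classical
  induction s using Finset.induction_on with
  | empty => simp
  | insert a s ha ih => rw [Finset.sum_insert ha, Finset.sum_insert ha, Quaternion.re_add, ih]

/-! ### Weighted sums over permutations -/

section Weights

variable {ι : Type*} [Fintype ι] [LinearOrder ι]

/-- A weight assigns a quaternion to a finite set `B` of base points and a function `g` (the cycle
products). It is local if it depends only on the values of `g` on `B`. -/
def IsLocalWeight (w : Finset ι → (ι → ℍ[ℝ]) → ℍ[ℝ]) : Prop :=
  ∀ B g g', (∀ s ∈ B, g s = g' s) → w B g = w B g'

/-- The signed sum over all permutations of `S`, each one weighted by `w` applied to its cycle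
products at the minimal elements of its cycles. -/
noncomputable def permSum (w : Finset ι → (ι → ℍ[ℝ]) → ℍ[ℝ]) (M : Matrix ι ι ℍ[ℝ])
    (S : Finset ι) : ℍ[ℝ] :=
  ∑ σ ∈ permsOn S, ((Equiv.Perm.sign σ : ℤ) : ℍ[ℝ]) * w (cycleMins σ S) (cycleProd M σ)

/-- The signed sum over all permutations of `S` in which the cycle through `j` contributes its
product at `j`, as the rightmost factor and with the `j`-th column of `M` replaced by `v`, and the
other cycles contribute through the weight `w`. -/
noncomputable def pointedSum (w : Finset ι → (ι → ℍ[ℝ]) → ℍ[ℝ]) (M : Matrix ι ι ℍ[ℝ])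
    (S : Finset ι) (j : ι) (v : ι → ℍ[ℝ]) : ℍ[ℝ] :=
  ∑ σ ∈ permsOn S, ((Equiv.Perm.sign σ : ℤ) : ℍ[ℝ]) *
    (w (otherMins σ S j) (cycleProd M σ) * cycleProd (M.updateCol j v) σ j)

/-- Expansion of a pointed sum along the element `a = σ j` that follows `j`, that is, along the
rightmost factor `v a` of the monomials. -/
theorem pointedSum_eq {w : Finset ι → (ι → ℍ[ℝ]) → ℍ[ℝ]} (hw : IsLocalWeight w)
    (M : Matrix ι ι ℍ[ℝ]) {S : Finset ι} {j : ι} (hj : j ∈ S) (v : ι → ℍ[ℝ]) :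
    pointedSum w M S j v = permSum w M (S.erase j) * v j -
      ∑ a ∈ S.erase j, pointedSum w M (S.erase a) j (M.col a) * v a := by
  unfold pointedSum
  rw [sum_permsOn hj, ← Finset.add_sum_erase _ _ hj, sub_eq_add_neg, ← Finset.sum_neg_distrib]
  congr 1
  · rw [permSum, Finset.sum_mul]
    refine Finset.sum_congr rfl fun σ hσ => ?_
    have hσj : σ j = j := mem_permsOn.1 hσ j (by simp)
    rw [Equiv.swap_self, show (Equiv.refl ι : Equiv.Perm ι) = 1 from rfl, mul_one,
      otherMins_fixed hσ, cycleProd_fixed _ hσj, Matrix.updateCol_self, mul_assoc]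
  · refine Finset.sum_congr rfl fun a ha => ?_
    have hja : j ≠ a := (Finset.ne_of_mem_erase ha).symm
    rw [Finset.sum_mul, ← Finset.sum_neg_distrib]
    refine Finset.sum_congr rfl fun τ hτ => ?_
    have hτa : τ a = a := mem_permsOn.1 hτ a (by simp)
    have hwt : w (otherMins τ (S.erase a) j) (cycleProd M (τ * Equiv.swap j a)) =
        w (otherMins τ (S.erase a) j) (cycleProd M τ) := by
      apply hw
      intro s hs
      simp only [otherMins, Finset.mem_filter, Finset.mem_erase] at hs
      exact cycleProd_congr (pow_mul_swap_apply hτa hs.1.1 hs.2.1) fun _ _ => rfl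
    rw [otherMins_mul_swap hτ, cycleProd_mul_swap M v hτa hja, hwt, Equiv.Perm.sign_mul,
      Equiv.Perm.sign_swap hja]
    push_cast
    noncomm_ring

theorem permSum_empty {w : Finset ι → (ι → ℍ[ℝ]) → ℍ[ℝ]} (M : Matrix ι ι ℍ[ℝ])
    (g : ι → ℍ[ℝ]) (hw : IsLocalWeight w) : permSum w M ∅ = w ∅ g := by
  have h : permsOn (∅ : Finset ι) = {1} := by
    ext σ
    simp [mem_permsOn, Equiv.Perm.ext_iff]
  have h2 : cycleMins (1 : Equiv.Perm ι) ∅ = ∅ := by simp [cycleMins]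
  rw [permSum, h, Finset.sum_singleton, h2, hw ∅ _ g (by simp)]
  simp

/-- The weight of a column determinant: the product of the values at the base points, arranged
from right to left in increasing order. -/
noncomputable def orderedWeight (B : Finset ι) (g : ι → ℍ[ℝ]) : ℍ[ℝ] :=
  ((B.sort (· ≤ ·)).reverse.map g).prod

/-- The commutative weight: the product of the real parts of the values at the base points. -/
noncomputable def realWeight (B : Finset ι) (g : ι → ℍ[ℝ]) : ℍ[ℝ] :=
  ((∏ s ∈ B, (g s).re : ℝ) : ℍ[ℝ])

theorem isLocalWeight_orderedWeight : IsLocalWeight (orderedWeight (ι := ι)) := by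
  intro B g g' h
  unfold orderedWeight
  congr 1
  apply List.map_congr_left
  intro s hs
  exact h s (by simpa using hs)

theorem isLocalWeight_realWeight : IsLocalWeight (realWeight (ι := ι)) := by
  intro B g g' h
  unfold realWeight
  rw [Finset.prod_congr rfl fun s hs => by rw [h s hs]]

/-- The commutative counterpart of the determinant of the principal submatrix on `S`: the cycle
products are replaced by their real parts. -/
noncomputable def realDet (M : Matrix ι ι ℍ[ℝ]) (S : Finset ι) : ℝ :=
  ∑ σ ∈ permsOn S, ((Equiv.Perm.sign σ : ℤ) : ℝ) * ∏ s ∈ cycleMins σ S, (cycleProd M σ s).re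

theorem permSum_realWeight (M : Matrix ι ι ℍ[ℝ]) (S : Finset ι) :
    permSum realWeight M S = (realDet M S : ℍ[ℝ]) := by
  unfold permSum realDet realWeight
  rw [quaternion_coe_sum]
  refine Finset.sum_congr rfl fun σ _ => ?_
  rw [Quaternion.coe_mul]
  rfl

/-- The real part of a pointed sum with respect to the commutative weight does not depend on the
distinguished element, since the real part of a cycle product does not depend on its base point. -/
theorem re_pointedSum_realWeight (M : Matrix ι ι ℍ[ℝ]) {S : Finset ι} {j : ι} (hj : j ∈ S) :
    (pointedSum realWeight M S j (M.col j)).re = realDet M S := by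
  unfold pointedSum realDet
  rw [quaternion_re_sum]
  refine Finset.sum_congr rfl fun σ hσ => ?_
  obtain ⟨s, h1, h2, h3⟩ := exists_cycleMins_eq_insert hσ hj
  have hM : M.updateCol j (M.col j) = M := Matrix.updateCol_eq_self M j
  rw [h3, Finset.prod_insert h2, hM, realWeight, re_cycleProd_sameCycle M h1,
    show (((Equiv.Perm.sign σ : ℤ) : ℍ[ℝ])) = (((Equiv.Perm.sign σ : ℤ) : ℝ) : ℍ[ℝ]) from rfl,
    Quaternion.coe_mul_eq_smul, Quaternion.coe_mul_eq_smul, Quaternion.re_smul,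
    Quaternion.re_smul, smul_eq_mul, smul_eq_mul]
  ring

/-- For the smallest element `j` of `S`, the ordered product of all cycles ends with the cycle
of `j`. -/
theorem pointedSum_orderedWeight_min (M : Matrix ι ι ℍ[ℝ]) {S : Finset ι} {j : ι} (hj : j ∈ S)
    (hmin : ∀ x ∈ S, j ≤ x) :
    pointedSum orderedWeight M S j (M.col j) = permSum orderedWeight M S := by
  unfold pointedSum permSum
  refine Finset.sum_congr rfl fun σ hσ => ?_
  obtain ⟨h1, h2⟩ := cycleMins_eq_insert_min hσ hj hmin
  have hM : M.updateCol j (M.col j) = M := Matrix.updateCol_eq_self M j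
  have hle : ∀ b ∈ otherMins σ S j, j ≤ b := fun b hb =>
    hmin b (Finset.mem_filter.1 hb).1
  rw [h2, hM, orderedWeight, orderedWeight, Finset.sort_insert _ hle h1]
  simp

end Weights

/-! ### The adjugate identity for Hermitian matrices -/

section Expansion

variable {ι : Type*} [Fintype ι] [LinearOrder ι]

/-- Expansion of the pointed sums with commutative weight along the leftmost factor of the
distinguished cycle. -/
theorem pointedSum_realWeight_eq_left (M : Matrix ι ι ℍ[ℝ]) {S : Finset ι} {j : ι} (hj : j ∈ S)
    (v : ι → ℍ[ℝ]) :
    pointedSum realWeight M S j v = realDet M (S.erase j) * v j -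
      ∑ i ∈ S.erase j, M j i * pointedSum realWeight M (S.erase j) i v := by
  induction S using Finset.strongInduction generalizing j v with
  | H S ih =>
    rw [pointedSum_eq isLocalWeight_realWeight M hj v, permSum_realWeight]
    congr 1
    have hL : ∀ a ∈ S.erase j, pointedSum realWeight M (S.erase a) j (M.col a) * v a =
        realDet M ((S.erase j).erase a) * M j a * v a -
          ∑ i ∈ (S.erase j).erase a,
            M j i * (pointedSum realWeight M ((S.erase j).erase a) i (M.col a) * v a) := by
      intro a ha
      have hja : j ≠ a := (Finset.ne_of_mem_erase ha).symm
      rw [ih (S.erase a) (Finset.erase_ssubset (Finset.mem_of_mem_erase ha))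
        (Finset.mem_erase.2 ⟨hja, hj⟩), sub_mul, Finset.sum_mul, Finset.erase_right_comm]
      simp only [mul_assoc, Matrix.col_apply]
    have hR : ∀ i ∈ S.erase j, M j i * pointedSum realWeight M (S.erase j) i v =
        realDet M ((S.erase j).erase i) * M j i * v i -
          ∑ a ∈ (S.erase j).erase i,
            M j i * (pointedSum realWeight M ((S.erase j).erase a) i (M.col a) * v a) := by
      intro i hi
      rw [pointedSum_eq isLocalWeight_realWeight M hi v, permSum_realWeight, mul_sub,
        Finset.mul_sum, ← mul_assoc, Quaternion.coe_commutes]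
    rw [Finset.sum_congr rfl hL, Finset.sum_congr rfl hR, Finset.sum_sub_distrib,
      Finset.sum_sub_distrib]
    congr 1
    apply Finset.sum_comm'
    intro a i
    simp only [Finset.mem_erase]
    tauto

/-- The entries of the adjugate of the principal submatrix on `S`: the coefficients of
`v ↦ pointedSum realWeight M S j v`. -/
noncomputable def adjEntry (M : Matrix ι ι ℍ[ℝ]) (S : Finset ι) (j a : ι) : ℍ[ℝ] :=
  if a = j then (realDet M (S.erase j) : ℍ[ℝ])
  else -pointedSum realWeight M (S.erase a) j (M.col a)

theorem pointedSum_realWeight_eq_sum (M : Matrix ι ι ℍ[ℝ]) {S : Finset ι} {j : ι} (hj : j ∈ S)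
    (v : ι → ℍ[ℝ]) :
    pointedSum realWeight M S j v = ∑ a ∈ S, adjEntry M S j a * v a := by
  rw [pointedSum_eq isLocalWeight_realWeight M hj v, permSum_realWeight,
    ← Finset.add_sum_erase _ _ hj, sub_eq_add_neg, ← Finset.sum_neg_distrib]
  congr 1
  · simp [adjEntry]
  · refine Finset.sum_congr rfl fun a ha => ?_
    rw [adjEntry, if_neg (Finset.ne_of_mem_erase ha), neg_mul]

theorem adjEntry_eq_right (M : Matrix ι ι ℍ[ℝ]) {S : Finset ι} {j a : ι} (hj : j ∈ S)
    (hja : a ≠ j) :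
    adjEntry M S j a = -∑ b ∈ S.erase a, adjEntry M (S.erase a) j b * M b a := by
  rw [adjEntry, if_neg hja, pointedSum_realWeight_eq_sum M (Finset.mem_erase.2 ⟨hja.symm, hj⟩)]
  rfl

theorem adjEntry_eq_left (M : Matrix ι ι ℍ[ℝ]) {S : Finset ι} {j a : ι} (hj : j ∈ S) (ha : a ∈ S)
    (hja : a ≠ j) :
    adjEntry M S j a = -∑ i ∈ S.erase j, M j i * adjEntry M (S.erase j) i a := by
  have hv : ∀ (T : Finset ι) (i : ι), i ∈ T → a ∈ T →
      pointedSum realWeight M T i (Pi.single a 1) = adjEntry M T i a := by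
    intro T i hi ha
    rw [pointedSum_realWeight_eq_sum M hi, Finset.sum_eq_single a]
    · simp
    · intro b _ hb
      simp [hb]
    · exact fun h => absurd ha h
  rw [← hv S j hj ha, pointedSum_realWeight_eq_left M hj, Pi.single_eq_of_ne hja.symm, mul_zero,
    zero_sub]
  congr 1
  refine Finset.sum_congr rfl fun i hi => ?_
  rw [hv _ i hi (Finset.mem_erase.2 ⟨hja, ha⟩)]

/-- The adjugate of a Hermitian matrix is Hermitian. -/
theorem star_adjEntry {H : Matrix ι ι ℍ[ℝ]} (hH : H.IsHermitian) {S : Finset ι} {j a : ι}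
    (hj : j ∈ S) (ha : a ∈ S) : star (adjEntry H S j a) = adjEntry H S a j := by
  induction S using Finset.strongInduction generalizing j a with
  | H S ih =>
    by_cases hja : a = j
    · subst hja
      simp [adjEntry]
    · rw [adjEntry_eq_left H hj ha hja, adjEntry_eq_right H ha (Ne.symm hja), star_neg, star_sum]
      congr 1
      refine Finset.sum_congr rfl fun i hi => ?_
      rw [star_mul, ih _ (Finset.erase_ssubset hj) hi (Finset.mem_erase.2 ⟨hja, ha⟩), hH.apply]

/-- For a Hermitian matrix, the pointed sum with the original column does not depend on the
distinguished element: it is real, and its real part is `realDet`. -/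
theorem pointedSum_realWeight_self {H : Matrix ι ι ℍ[ℝ]} (hH : H.IsHermitian) {S : Finset ι}
    {j : ι} (hj : j ∈ S) : pointedSum realWeight H S j (H.col j) = realDet H S := by
  have hs : star (pointedSum realWeight H S j (H.col j)) =
      pointedSum realWeight H S j (H.col j) := by
    have hexp : pointedSum realWeight H S j (H.col j) = realDet H (S.erase j) * H j j -
        ∑ i ∈ S.erase j, ∑ a ∈ S.erase j, H j i * adjEntry H (S.erase j) i a * H a j := by
      rw [pointedSum_realWeight_eq_left H hj]
      congr 1
      refine Finset.sum_congr rfl fun i hi => ?_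
      rw [pointedSum_realWeight_eq_sum H hi, Finset.mul_sum]
      simp only [mul_assoc, Matrix.col_apply]
    rw [hexp, star_sub, star_mul, Quaternion.star_coe, hH.apply, Quaternion.coe_commutes, star_sum]
    congr 1
    simp only [star_sum]
    rw [Finset.sum_comm]
    refine Finset.sum_congr rfl fun i hi => Finset.sum_congr rfl fun a ha => ?_
    rw [star_mul, star_mul, star_adjEntry hH ha hi, hH.apply, hH.apply, mul_assoc]
  rw [← re_pointedSum_realWeight H hj]
  exact Quaternion.star_eq_self.1 hs

/-- For a Hermitian matrix, replacing the column of the distinguished element by another column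
of `S` gives zero. -/
theorem pointedSum_realWeight_other {H : Matrix ι ι ℍ[ℝ]} (hH : H.IsHermitian) {S : Finset ι}
    {j m : ι} (hj : j ∈ S) (hm : m ∈ S) (hjm : j ≠ m) :
    pointedSum realWeight H S j (H.col m) = 0 := by
  induction S using Finset.strongInduction generalizing j with
  | H S ih =>
    have hm' : m ∈ S.erase j := Finset.mem_erase.2 ⟨hjm.symm, hm⟩
    rw [pointedSum_realWeight_eq_left H hj, Finset.sum_eq_single m,
      pointedSum_realWeight_self hH hm', Quaternion.coe_commutes, Matrix.col_apply, sub_self]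
    · intro i hi him
      rw [ih _ (Finset.erase_ssubset hj) hi hm' him, mul_zero]
    · exact fun h => absurd hm' h

/-- For a Hermitian matrix the order of the cycles and the choice of their base points do not
matter: the ordered sum over permutations equals the commutative one. -/
theorem permSum_orderedWeight {H : Matrix ι ι ℍ[ℝ]} (hH : H.IsHermitian) (S : Finset ι) :
    permSum orderedWeight H S = realDet H S ∧
      ∀ j ∈ S, ∀ v, pointedSum orderedWeight H S j v = pointedSum realWeight H S j v := by
  induction S using Finset.strongInduction with
  | H S ih =>
    have h2 : ∀ j ∈ S, ∀ v,
        pointedSum orderedWeight H S j v = pointedSum realWeight H S j v := by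
      intro j hj v
      rw [pointedSum_eq isLocalWeight_orderedWeight H hj,
        pointedSum_eq isLocalWeight_realWeight H hj, (ih _ (Finset.erase_ssubset hj)).1,
        permSum_realWeight]
      congr 1
      refine Finset.sum_congr rfl fun a ha => ?_
      rw [(ih _ (Finset.erase_ssubset (Finset.mem_of_mem_erase ha))).2 j
        (Finset.mem_erase.2 ⟨(Finset.ne_of_mem_erase ha).symm, hj⟩)]
    refine ⟨?_, h2⟩
    rcases S.eq_empty_or_nonempty with rfl | hne
    · rw [← permSum_realWeight, permSum_empty H 0 isLocalWeight_orderedWeight,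
        permSum_empty H 0 isLocalWeight_realWeight]
      simp [orderedWeight, realWeight]
    · have hj := S.min'_mem hne
      rw [← pointedSum_orderedWeight_min H hj (fun x hx => S.min'_le x hx), h2 _ hj,
        pointedSum_realWeight_self hH hj]

end Expansion

/-! ### Column determinants of principal submatrices -/

section Transfer

variable {n : ℕ}

theorem ofSubtype_pow_apply {β : Finset (Fin n)} (σ : Equiv.Perm {x // x ∈ β})
    (s : {x // x ∈ β}) (p : ℕ) :
    ((Equiv.Perm.ofSubtype σ) ^ p) (s : Fin n) = ((σ ^ p) s : {x // x ∈ β}) := by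
  rw [← map_pow, Equiv.Perm.ofSubtype_apply_coe]

theorem cycleProd_principal (M : Matrix (Fin n) (Fin n) ℍ[ℝ]) {β : Finset (Fin n)}
    (σ : Equiv.Perm {x // x ∈ β}) (s : {x // x ∈ β}) :
    cycleProd (principal M β) σ s = cycleProd M (Equiv.Perm.ofSubtype σ) s := by
  have hp : Function.minimalPeriod σ s =
      Function.minimalPeriod (Equiv.Perm.ofSubtype σ) (s : Fin n) := by
    rw [Function.minimalPeriod_eq_minimalPeriod_iff]
    intro k
    rw [isPeriodicPt_perm, isPeriodicPt_perm, ofSubtype_pow_apply, Subtype.ext_iff]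
  unfold cycleProd
  rw [hp]
  congr 1
  apply List.map_congr_left
  intro p _
  rw [ofSubtype_pow_apply, ofSubtype_pow_apply]
  rfl

theorem sameCycle_ofSubtype {β : Finset (Fin n)} (σ : Equiv.Perm {x // x ∈ β})
    (s t : {x // x ∈ β}) :
    (Equiv.Perm.ofSubtype σ).SameCycle (s : Fin n) t ↔ σ.SameCycle s t := by
  simp only [sameCycle_iff_nat, ofSubtype_pow_apply, Subtype.ext_iff]

theorem ofSubtype_mem_permsOn {β : Finset (Fin n)} (σ : Equiv.Perm {x // x ∈ β}) :
    Equiv.Perm.ofSubtype σ ∈ permsOn β :=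
  mem_permsOn.2 fun _ hx => Equiv.Perm.ofSubtype_apply_of_not_mem σ hx

theorem map_otherBases {β : Finset (Fin n)} (σ : Equiv.Perm {x // x ∈ β}) (j : {x // x ∈ β}) :
    (otherBases σ j).map Subtype.val =
      (otherMins (Equiv.Perm.ofSubtype σ) β j).sort (· ≤ ·) := by
  unfold otherBases
  have h := Finset.map_sort (Function.Embedding.subtype (fun x => x ∈ β))
    (otherMins σ Finset.univ j) (· ≤ ·) (· ≤ ·) (fun a _ b _ => Iff.rfl)
  have h2 : (otherMins σ Finset.univ j).map (Function.Embedding.subtype (fun x => x ∈ β)) =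
      otherMins (Equiv.Perm.ofSubtype σ) β j := by
    ext x
    simp only [otherMins, Finset.mem_map, Finset.mem_filter, Finset.mem_univ, true_and,
      Function.Embedding.subtype_apply]
    constructor
    · rintro ⟨y, ⟨h1, h2⟩, rfl⟩
      refine ⟨y.2, by rwa [sameCycle_ofSubtype], fun s' hs' => ?_⟩
      have hm := sameCycle_mem (ofSubtype_mem_permsOn σ) y.2 hs'
      exact h2 ⟨s', hm⟩ ((sameCycle_ofSubtype σ y ⟨s', hm⟩).1 hs')
    · rintro ⟨h0, h1, h2⟩
      refine ⟨⟨x, h0⟩, ⟨?_, fun s' hs' => ?_⟩, rfl⟩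
      · rwa [← sameCycle_ofSubtype]
      · exact h2 s' ((sameCycle_ofSubtype σ ⟨x, h0⟩ s').2 hs')
  rw [← h2, ← h]
  rfl

/-- The column determinant of a principal submatrix as a sum over permutations of the full
index set. -/
theorem cdet_principal (M : Matrix (Fin n) (Fin n) ℍ[ℝ]) {β : Finset (Fin n)} (j : {x // x ∈ β}) :
    cdet (principal M β) j = ∑ σ ∈ permsOn β, ((Equiv.Perm.sign σ : ℤ) : ℍ[ℝ]) *
      (orderedWeight (otherMins σ β j) (cycleProd M σ) * cycleProd M σ j) := by
  unfold cdet
  refine Finset.sum_bij (fun σ _ => Equiv.Perm.ofSubtype σ) (fun σ _ => ofSubtype_mem_permsOn σ)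
    (fun σ _ τ _ h => Equiv.Perm.ofSubtype_injective h) ?_ ?_
  · intro τ hτ
    refine ⟨τ.subtypePerm fun x => ?_, Finset.mem_univ _, ?_⟩
    · constructor
      · intro h
        by_contra hx
        exact hx (by rwa [mem_permsOn.1 hτ x hx] at h)
      · exact permsOn_apply_mem hτ
    · apply Equiv.Perm.ofSubtype_subtypePerm
      intro x hx
      by_contra h
      exact hx (mem_permsOn.1 hτ x h)
  · intro σ _
    rw [Equiv.Perm.sign_ofSubtype]
    congr 1
    rw [orderedWeight, ← map_otherBases, ← List.map_reverse, List.map_map, List.reverse_cons,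
      List.map_append, List.prod_append, List.map_singleton, List.prod_singleton,
      cycleProd_principal]
    congr 2
    apply List.map_congr_left
    intro s _
    exact cycleProd_principal M σ s

/-- A cycle that avoids `j` does not meet the `j`-th column. -/
theorem cycleProd_updateCol (M : Matrix (Fin n) (Fin n) ℍ[ℝ]) {σ : Equiv.Perm (Fin n)}
    {j s : Fin n} (v : Fin n → ℍ[ℝ]) (h : ¬ σ.SameCycle j s) :
    cycleProd (M.updateCol j v) σ s = cycleProd M σ s := by
  apply cycleProd_congr (fun _ => rfl)
  intro m x
  rw [Matrix.updateCol_ne]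
  exact fun hm => h (sameCycle_iff_nat.2 ⟨m, hm⟩).symm

theorem cdet_principal_updateCol (M : Matrix (Fin n) (Fin n) ℍ[ℝ]) {β : Finset (Fin n)}
    (j : {x // x ∈ β}) (v : Fin n → ℍ[ℝ]) :
    cdet (principal (M.updateCol j v) β) j = pointedSum orderedWeight M β j v := by
  rw [cdet_principal, pointedSum]
  refine Finset.sum_congr rfl fun σ _ => ?_
  congr 2
  apply isLocalWeight_orderedWeight
  intro s hs
  simp only [otherMins, Finset.mem_filter] at hs
  exact cycleProd_updateCol M v hs.2.1

theorem hermDet_principal {H : Matrix (Fin n) (Fin n) ℍ[ℝ]} (hH : H.IsHermitian)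
    (β : Finset (Fin n)) : hermDet (principal H β) = realDet H β := by
  unfold hermDet
  split_ifs with h
  · have hM : H.updateCol _ (H.col _) = H :=
      Matrix.updateCol_eq_self H (Finset.univ.min' h : {x // x ∈ β}).1
    conv_lhs => rw [← hM]
    rw [cdet_principal_updateCol, (permSum_orderedWeight hH β).2 _ (Subtype.coe_prop _),
      pointedSum_realWeight_self hH (Subtype.coe_prop _)]
  · have hβ : β = ∅ := by
      rw [Finset.eq_empty_iff_forall_notMem]
      exact fun x hx => h ⟨⟨x, hx⟩, Finset.mem_univ _⟩
    subst hβ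
    rw [← permSum_realWeight, permSum_empty H 0 isLocalWeight_realWeight]
    simp [realWeight]

/-- The sum of the principal minors of order `l` of a Hermitian matrix, as a real number. -/
noncomputable def realMinorSum (l : ℕ) (H : Matrix (Fin n) (Fin n) ℍ[ℝ]) : ℝ :=
  ∑ β ∈ Finset.univ.filter (fun β : Finset (Fin n) => β.card = l), realDet H β

theorem minorSum_eq {H : Matrix (Fin n) (Fin n) ℍ[ℝ]} (hH : H.IsHermitian) (l : ℕ) :
    minorSum l H = (realMinorSum l H : ℍ[ℝ]) := by
  rw [minorSum, realMinorSum, quaternion_coe_sum]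
  rw [← Finset.sum_subtype_eq_sum_filter]
  simp only [hermDet_principal hH, Finset.subtype_univ]

theorem cdetSum_eq {H : Matrix (Fin n) (Fin n) ℍ[ℝ]} (hH : H.IsHermitian) (l : ℕ) (i : Fin n)
    (v : Fin n → ℍ[ℝ]) :
    cdetSum l H i v =
      ∑ β ∈ Finset.univ.filter (fun β : Finset (Fin n) => β.card = l ∧ i ∈ β),
        pointedSum realWeight H β i v := by
  rw [cdetSum, ← Finset.sum_subtype_eq_sum_filter, Finset.subtype_univ]
  refine Finset.sum_congr rfl fun β _ => ?_
  rw [← (permSum_orderedWeight hH β).2 i β.2.2]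
  exact cdet_principal_updateCol H ⟨i, β.2.2⟩ v

end Transfer

/-! ### Sums of adjugates and of principal minors -/

section AdjugateSums

variable {n : ℕ}

/-- The matrix of the map `v ↦ cdetSum l H · v`: a sum of adjugates of principal submatrices of
order `l`. -/
noncomputable def adjSum (l : ℕ) (H : Matrix (Fin n) (Fin n) ℍ[ℝ]) :
    Matrix (Fin n) (Fin n) ℍ[ℝ] :=
  fun i a => ∑ β ∈ Finset.univ.filter (fun β : Finset (Fin n) => β.card = l ∧ i ∈ β),
    if a ∈ β then adjEntry H β i a else 0

theorem adjSum_mulVec {H : Matrix (Fin n) (Fin n) ℍ[ℝ]} (hH : H.IsHermitian) (l : ℕ)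
    (v : Fin n → ℍ[ℝ]) (i : Fin n) : (adjSum l H *ᵥ v) i = cdetSum l H i v := by
  rw [cdetSum_eq hH, Matrix.mulVec, dotProduct]
  simp only [adjSum, Finset.sum_mul]
  rw [Finset.sum_comm]
  refine Finset.sum_congr rfl fun β hβ => ?_
  rw [pointedSum_realWeight_eq_sum H (Finset.mem_filter.1 hβ).2.2]
  simp [ite_mul, Finset.sum_ite_mem]

theorem adjSum_zero (H : Matrix (Fin n) (Fin n) ℍ[ℝ]) : adjSum 0 H = 0 := by
  ext1 i a
  rw [adjSum, Finset.sum_eq_zero]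
  · rfl
  · intro β hβ
    simp only [Finset.mem_filter, Finset.card_eq_zero] at hβ
    simp [hβ.2.1] at hβ

theorem adjSum_of_lt (H : Matrix (Fin n) (Fin n) ℍ[ℝ]) {l : ℕ} (hl : n < l) :
    adjSum l H = 0 := by
  ext1 i a
  rw [adjSum, Finset.sum_eq_zero]
  · rfl
  · intro β hβ
    have h1 := (Finset.mem_filter.1 hβ).2.1
    have h2 := Finset.card_le_univ β
    simp only [Fintype.card_fin] at h2
    omega

theorem realMinorSum_zero (H : Matrix (Fin n) (Fin n) ℍ[ℝ]) : realMinorSum 0 H = 1 := by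
  have h := permSum_realWeight H ∅
  rw [permSum_empty H 0 isLocalWeight_realWeight, realWeight, Finset.prod_empty] at h
  have h2 : realDet H ∅ = 1 := (Quaternion.coe_injective h).symm
  simp [realMinorSum, Finset.card_eq_zero, Finset.filter_eq', h2]

theorem realMinorSum_of_lt (H : Matrix (Fin n) (Fin n) ℍ[ℝ]) {l : ℕ} (hl : n < l) :
    realMinorSum l H = 0 := by
  rw [realMinorSum, Finset.sum_eq_zero]
  intro β hβ
  have h1 := (Finset.mem_filter.1 hβ).2
  have h2 := Finset.card_le_univ β
  simp only [Fintype.card_fin] at h2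
  omega

theorem adjSum_mul_apply {H : Matrix (Fin n) (Fin n) ℍ[ℝ]} (hH : H.IsHermitian) (l : ℕ)
    (i m : Fin n) : (adjSum l H * H) i m =
      ∑ β ∈ Finset.univ.filter (fun β : Finset (Fin n) => β.card = l ∧ i ∈ β),
        pointedSum realWeight H β i (H.col m) := by
  rw [← cdetSum_eq hH, ← adjSum_mulVec hH]
  rfl

/-- The Faddeev–LeVerrier recursion: an adjugate of order `l + 1` is expanded along its rightmost
factor, and the adjugate identity supplies the missing terms. -/
theorem adjSum_succ {H : Matrix (Fin n) (Fin n) ℍ[ℝ]} (hH : H.IsHermitian) (l : ℕ) :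
    adjSum (l + 1) H = realMinorSum l H • (1 : Matrix (Fin n) (Fin n) ℍ[ℝ]) - adjSum l H * H := by
  ext1 i a
  rw [Matrix.sub_apply, Matrix.smul_apply, adjSum_mul_apply hH, eq_sub_iff_add_eq]
  -- Both sums over `β` are compared through `γ = β \ {a}`.
  by_cases hia : a = i
  · subst hia
    have h1 : adjSum (l + 1) H a a =
        ∑ γ ∈ Finset.univ.filter (fun γ : Finset (Fin n) => γ.card = l ∧ a ∉ γ),
          (realDet H γ : ℍ[ℝ]) := by
      rw [adjSum]
      refine Finset.sum_bij' (fun β _ => β.erase a) (fun γ _ => insert a γ) ?_ ?_ ?_ ?_ ?_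
      · intro β hβ
        simp only [Finset.mem_filter, Finset.mem_univ, true_and] at hβ ⊢
        exact ⟨by rw [Finset.card_erase_of_mem hβ.2, hβ.1]; rfl, by simp⟩
      · intro γ hγ
        simp only [Finset.mem_filter, Finset.mem_univ, true_and] at hγ ⊢
        exact ⟨by rw [Finset.card_insert_of_notMem hγ.2, hγ.1], by simp⟩
      · intro β hβ
        exact Finset.insert_erase (Finset.mem_filter.1 hβ).2.2
      · intro γ hγ
        exact Finset.erase_insert (Finset.mem_filter.1 hγ).2.2
      · intro β hβ
        rw [if_pos (Finset.mem_filter.1 hβ).2.2, adjEntry, if_pos rfl]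
    have h2 : ∑ β ∈ Finset.univ.filter (fun β : Finset (Fin n) => β.card = l ∧ a ∈ β),
        pointedSum realWeight H β a (H.col a) =
        ∑ β ∈ Finset.univ.filter (fun β : Finset (Fin n) => β.card = l ∧ a ∈ β),
          (realDet H β : ℍ[ℝ]) :=
      Finset.sum_congr rfl fun β hβ =>
        pointedSum_realWeight_self hH (Finset.mem_filter.1 hβ).2.2
    rw [h1, h2, Matrix.one_apply_eq, realMinorSum, ← Quaternion.coe_mul_eq_smul, mul_one,
      quaternion_coe_sum, add_comm, ← Finset.filter_filter,
      ← Finset.filter_filter]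
    exact Finset.sum_filter_add_sum_filter_not _ _ _
  · rw [Matrix.one_apply_ne (Ne.symm hia), smul_zero]
    have h1 : adjSum (l + 1) H i a =
        -∑ γ ∈ Finset.univ.filter (fun γ : Finset (Fin n) => (γ.card = l ∧ i ∈ γ) ∧ a ∉ γ),
          pointedSum realWeight H γ i (H.col a) := by
      rw [adjSum, ← Finset.sum_filter, Finset.filter_filter, ← Finset.sum_neg_distrib]
      refine Finset.sum_bij' (fun β _ => β.erase a) (fun γ _ => insert a γ) ?_ ?_ ?_ ?_ ?_
      · intro β hβ
        simp only [Finset.mem_filter, Finset.mem_univ, true_and] at hβ ⊢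
        exact ⟨⟨by rw [Finset.card_erase_of_mem hβ.2, hβ.1.1]; rfl,
          Finset.mem_erase.2 ⟨Ne.symm hia, hβ.1.2⟩⟩, by simp⟩
      · intro γ hγ
        simp only [Finset.mem_filter, Finset.mem_univ, true_and] at hγ ⊢
        exact ⟨⟨by rw [Finset.card_insert_of_notMem hγ.2, hγ.1.1],
          Finset.mem_insert_of_mem hγ.1.2⟩, by simp⟩
      · intro β hβ
        exact Finset.insert_erase (Finset.mem_filter.1 hβ).2.2
      · intro γ hγ
        exact Finset.erase_insert (Finset.mem_filter.1 hγ).2.2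
      · intro β hβ
        rw [adjEntry, if_neg hia]
    rw [h1, neg_add_eq_zero, ← Finset.filter_filter]
    apply Finset.sum_subset (Finset.filter_subset _ _)
    intro γ hγ hγ'
    have ha : a ∈ γ := by
      by_contra ha
      exact hγ' (Finset.mem_filter.2 ⟨hγ, ha⟩)
    exact pointedSum_realWeight_other hH (Finset.mem_filter.1 hγ).2.2 ha (Ne.symm hia)

/-- Each principal minor of order `l` is counted once for each of its `l` indices in the trace. -/
theorem trace_adjSum_mul {H : Matrix (Fin n) (Fin n) ℍ[ℝ]} (hH : H.IsHermitian) (l : ℕ) :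
    (adjSum l H * H).trace = ((l * realMinorSum l H : ℝ) : ℍ[ℝ]) := by
  simp only [Matrix.trace, Matrix.diag_apply, adjSum_mul_apply hH]
  have h : ∀ i : Fin n,
      ∑ β ∈ Finset.univ.filter (fun β : Finset (Fin n) => β.card = l ∧ i ∈ β),
        pointedSum realWeight H β i (H.col i) =
      ∑ β ∈ Finset.univ.filter (fun β : Finset (Fin n) => β.card = l),
        if i ∈ β then (realDet H β : ℍ[ℝ]) else 0 := by
    intro i
    rw [← Finset.filter_filter, Finset.sum_filter]
    refine Finset.sum_congr rfl fun β _ => ?_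
    split_ifs with hi
    · exact pointedSum_realWeight_self hH hi
    · rfl
  simp only [h]
  rw [Finset.sum_comm, realMinorSum, Finset.mul_sum, quaternion_coe_sum]
  refine Finset.sum_congr rfl fun β hβ => ?_
  rw [Finset.sum_ite_mem, Finset.univ_inter, Finset.sum_const, (Finset.mem_filter.1 hβ).2,
    Quaternion.coe_mul, nsmul_eq_mul]
  rfl

end AdjugateSums

/-! ### Rank and trace -/

section Rank

variable {n : ℕ}

instance : Module.Finite ℍ[ℝ]ᵐᵒᵖ ℍ[ℝ] := by
  refine ⟨{1}, ?_⟩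
  rw [Finset.coe_singleton, Submodule.eq_top_iff']
  intro x
  exact Submodule.mem_span_singleton.2 ⟨MulOpposite.op x, by simp⟩

/-- Left multiplication of column vectors by a matrix, as a map of right `ℍ`-spaces. -/
def colLin (A : Matrix (Fin n) (Fin n) ℍ[ℝ]) : (Fin n → ℍ[ℝ]) →ₗ[ℍ[ℝ]ᵐᵒᵖ] (Fin n → ℍ[ℝ]) where
  toFun := A.mulVec
  map_add' := A.mulVec_add
  map_smul' c v := A.mulVec_smul c v

theorem colLin_apply (A : Matrix (Fin n) (Fin n) ℍ[ℝ]) (v : Fin n → ℍ[ℝ]) :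
    colLin A v = A *ᵥ v := rfl

theorem sum_op_smul_single (v : Fin n → ℍ[ℝ]) :
    ∑ x, MulOpposite.op (v x) • (Pi.single x 1 : Fin n → ℍ[ℝ]) = v := by
  ext1 y
  simp [Finset.sum_apply, Pi.single_apply, Finset.sum_ite_eq]

theorem range_colLin (A : Matrix (Fin n) (Fin n) ℍ[ℝ]) :
    LinearMap.range (colLin A) = Submodule.span ℍ[ℝ]ᵐᵒᵖ (Set.range A.col) := by
  apply le_antisymm
  · rintro _ ⟨v, rfl⟩
    rw [← sum_op_smul_single v, map_sum]
    refine Submodule.sum_mem _ fun x _ => ?_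
    rw [map_smul]
    refine Submodule.smul_mem _ _ (Submodule.subset_span ⟨x, ?_⟩)
    rw [colLin_apply, Matrix.mulVec_single_one]
  · rw [Submodule.span_le]
    rintro _ ⟨x, rfl⟩
    exact ⟨Pi.single x 1, by rw [colLin_apply, Matrix.mulVec_single_one]⟩

theorem qrank_eq (A : Matrix (Fin n) (Fin n) ℍ[ℝ]) :
    qrank A = Module.finrank ℍ[ℝ]ᵐᵒᵖ (LinearMap.range (colLin A)) := by
  rw [range_colLin, qrank]

theorem range_colLin_mul_le (A B : Matrix (Fin n) (Fin n) ℍ[ℝ]) :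
    LinearMap.range (colLin (A * B)) ≤ LinearMap.range (colLin A) := by
  rintro _ ⟨v, rfl⟩
  exact ⟨B *ᵥ v, by simp [colLin_apply]⟩

/-- Inclusion of column spaces is divisibility. -/
theorem exists_eq_mul_of_range_le {A B : Matrix (Fin n) (Fin n) ℍ[ℝ]}
    (h : LinearMap.range (colLin A) ≤ LinearMap.range (colLin B)) : ∃ U, A = B * U := by
  have h1 : ∀ x, ∃ u, B *ᵥ u = A.col x := fun x =>
    h ⟨Pi.single x 1, by rw [colLin_apply, Matrix.mulVec_single_one]⟩
  choose u hu using h1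
  refine ⟨Matrix.of fun y x => u x y, ?_⟩
  ext1 y x
  exact (congrFun (hu x) y).symm

theorem qrank_add_finrank_ker (A : Matrix (Fin n) (Fin n) ℍ[ℝ]) :
    qrank A + Module.finrank ℍ[ℝ]ᵐᵒᵖ (LinearMap.ker (colLin A)) =
      Module.finrank ℍ[ℝ]ᵐᵒᵖ (Fin n → ℍ[ℝ]) := by
  rw [qrank_eq]
  exact LinearMap.finrank_range_add_finrank_ker _

/-- The real part of the trace of an idempotent quaternion matrix is its rank. -/
theorem re_trace_of_idempotent {P : Matrix (Fin n) (Fin n) ℍ[ℝ]} (hP : P * P = P) :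
    P.trace.re = qrank P := by
  -- A basis of the column space gives a factorization `P = E * F` with `F * E = 1`.
  rw [qrank_eq]
  set V := LinearMap.range (colLin P) with hV
  have hcoe : ∀ v, (((colLin P).rangeRestrict v : V) : Fin n → ℍ[ℝ]) = P *ᵥ v := fun _ => rfl
  let b := Module.finBasis ℍ[ℝ]ᵐᵒᵖ V
  let φ := b.repr.toLinearMap ∘ₗ (colLin P).rangeRestrict
  let E : Matrix (Fin n) (Fin (Module.finrank ℍ[ℝ]ᵐᵒᵖ V)) ℍ[ℝ] :=
    fun x i => (b i : Fin n → ℍ[ℝ]) x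
  let F : Matrix (Fin (Module.finrank ℍ[ℝ]ᵐᵒᵖ V)) (Fin n) ℍ[ℝ] :=
    fun i x => (φ (Pi.single x 1) i).unop
  have hEF : E * F = P := by
    ext1 x y
    have h := congrArg (fun v : V => (v : Fin n → ℍ[ℝ]) x)
      (b.sum_repr ((colLin P).rangeRestrict (Pi.single y 1)))
    simp only [hcoe, Matrix.mulVec_single_one, Matrix.col_apply] at h
    rw [Matrix.mul_apply]
    refine Eq.trans ?_ h
    rw [Submodule.coe_sum, Finset.sum_apply]
    rfl
  have hφ : ∀ v i, (φ v i).unop = ∑ x, F i x * v x := by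
    intro v i
    conv_lhs => rw [← sum_op_smul_single v]
    rw [map_sum, Finsupp.finsetSum_apply, Finset.unop_sum]
    refine Finset.sum_congr rfl fun x _ => ?_
    rw [map_smul, Finsupp.smul_apply]
    simp [F]
  have hFE : F * E = 1 := by
    ext1 i k
    have h1 : (colLin P).rangeRestrict (b k : Fin n → ℍ[ℝ]) = b k := by
      obtain ⟨u, hu⟩ := (b k).2
      apply Subtype.ext
      rw [hcoe, ← hu, colLin_apply, Matrix.mulVec_mulVec, hP]
    have h2 := hφ (b k) i
    rw [Matrix.mul_apply, ← h2]
    simp only [φ, LinearMap.comp_apply, h1]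
    simp [Finsupp.single_apply, Matrix.one_apply, eq_comm, apply_ite MulOpposite.unop]
  have hc : (E * F).trace.re = (F * E).trace.re := by
    simp only [Matrix.trace, Matrix.diag_apply, Matrix.mul_apply, quaternion_re_sum]
    rw [Finset.sum_comm]
    refine Finset.sum_congr rfl fun i _ => Finset.sum_congr rfl fun x _ => ?_
    simp only [Quaternion.re_mul]
    ring
  rw [← hEF, hc, hFE, Matrix.trace_one]
  simp

end Rank

/-! ### Hermitian matrices and their rank -/

section Hermitian

variable {n : ℕ}

theorem eq_zero_of_mul_conjTranspose_self {Y : Matrix (Fin n) (Fin n) ℍ[ℝ]} (h : Y * Yᴴ = 0) :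
    Y = 0 := by
  ext1 i x
  have h1 := congrArg QuaternionAlgebra.re (congrFun (congrFun h i) i)
  simp only [Matrix.mul_apply, Matrix.conjTranspose_apply, Quaternion.self_mul_star,
    quaternion_re_sum, Quaternion.re_coe, Matrix.zero_apply, Quaternion.re_zero] at h1
  rw [Finset.sum_eq_zero_iff_of_nonneg fun _ _ => Quaternion.normSq_nonneg] at h1
  exact Quaternion.normSq_eq_zero.1 (h1 x (Finset.mem_univ x))

theorem mul_eq_zero_of_conjTranspose_mul {B X : Matrix (Fin n) (Fin n) ℍ[ℝ]}
    (h : Bᴴ * B * X = 0) : B * X = 0 := by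
  have h1 : (B * X)ᴴ * ((B * X)ᴴ)ᴴ = 0 := by
    rw [Matrix.conjTranspose_conjTranspose, Matrix.conjTranspose_mul, Matrix.mul_assoc,
      ← Matrix.mul_assoc Bᴴ, h, Matrix.mul_zero]
  exact Matrix.conjTranspose_eq_zero.1 (eq_zero_of_mul_conjTranspose_self h1)

theorem mul_eq_zero_of_mul_pow {Y H : Matrix (Fin n) (Fin n) ℍ[ℝ]} (hH : H.IsHermitian) {m : ℕ}
    (h : Y * H ^ (m + 1) = 0) : Y * H = 0 := by
  induction m with
  | zero => simpa using h
  | succ m ih =>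
    apply ih
    apply eq_zero_of_mul_conjTranspose_self
    rw [Matrix.conjTranspose_mul, (hH.pow (m + 1)).eq, ← Matrix.mul_assoc, Matrix.mul_assoc Y,
      ← pow_add, show m + 1 + (m + 1) = m + 1 + 1 + m by ring, pow_add, ← Matrix.mul_assoc Y, h,
      Matrix.zero_mul, Matrix.zero_mul]

theorem commute_adjSum {H : Matrix (Fin n) (Fin n) ℍ[ℝ]} (hH : H.IsHermitian) (l : ℕ) :
    H * adjSum l H = adjSum l H * H := by
  induction l with
  | zero => simp [adjSum_zero]
  | succ l ih =>
    rw [adjSum_succ hH, Matrix.mul_sub, Matrix.sub_mul, ← Matrix.mul_assoc, ih]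
    simp

/-- For a Hermitian matrix `H` of rank `r`, the sum of the principal minors of order `r` does not
vanish, and `adjSum r H` divided by it inverts `H` on the column space of `H`. -/
theorem adjSum_qrank {H : Matrix (Fin n) (Fin n) ℍ[ℝ]} (hH : H.IsHermitian) {r : ℕ}
    (hr : qrank H = r) :
    realMinorSum r H ≠ 0 ∧ adjSum r H * H * H = realMinorSum r H • H := by
  classical
  -- `s` is the largest order with a nonzero sum of principal minors; the trace shows `s = r`.
  obtain ⟨s, hs, hgt⟩ : ∃ s, realMinorSum s H ≠ 0 ∧ ∀ l, s < l → realMinorSum l H = 0 := by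
    refine ⟨Nat.findGreatest (fun l => realMinorSum l H ≠ 0) n, ?_, fun l hl => ?_⟩
    · exact Nat.findGreatest_spec (P := fun l => realMinorSum l H ≠ 0) (Nat.zero_le n)
        (by rw [realMinorSum_zero]; exact one_ne_zero)
    · rcases le_or_gt l n with hln | hln
      · simpa using Nat.findGreatest_is_greatest hl hln
      · exact realMinorSum_of_lt H hln
  have hpow : ∀ m, adjSum (s + 1) H * H ^ m = (-1 : ℝ) ^ m • adjSum (s + 1 + m) H := by
    intro m
    induction m with
    | zero => simp
    | succ m ih =>
      rw [pow_succ, ← Matrix.mul_assoc, ih, ← Nat.add_assoc, adjSum_succ hH, hgt _ (by omega),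
        zero_smul, zero_sub, Matrix.smul_mul, pow_succ, mul_smul]
      simp
  have hzero : adjSum (s + 1) H * H = 0 := by
    apply mul_eq_zero_of_mul_pow hH (m := n)
    rw [hpow, adjSum_of_lt H (by omega), smul_zero]
  have hCHH : adjSum s H * H * H = realMinorSum s H • H := by
    rw [adjSum_succ hH, Matrix.sub_mul, Matrix.smul_mul, Matrix.one_mul, sub_eq_zero] at hzero
    exact hzero.symm
  set d := realMinorSum s H with hd
  set P := d⁻¹ • (adjSum s H * H) with hP
  have hPH : P * H = H := by
    rw [hP, Matrix.smul_mul, hCHH, smul_smul, inv_mul_cancel₀ hs, one_smul]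
  have hP' : P = H * (d⁻¹ • adjSum s H) := by
    rw [Matrix.mul_smul, commute_adjSum hH]
  have hPP : P * P = P := by
    nth_rewrite 2 [hP']
    rw [← Matrix.mul_assoc, hPH, ← hP']
  have hrank : qrank P = qrank H := by
    have hle : LinearMap.range (colLin P) ≤ LinearMap.range (colLin H) := by
      rw [hP']
      exact range_colLin_mul_le _ _
    have hge : LinearMap.range (colLin H) ≤ LinearMap.range (colLin P) := by
      have h := range_colLin_mul_le P H
      rwa [hPH] at h
    rw [qrank_eq, qrank_eq, le_antisymm hle hge]
  have htr := re_trace_of_idempotent hPP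
  rw [hrank, hr, hP, Matrix.trace_smul, trace_adjSum_mul hH, Quaternion.re_smul,
    Quaternion.re_coe, ← hd, smul_eq_mul, mul_comm, mul_assoc, mul_inv_cancel₀ hs, mul_one] at htr
  have hsr : s = r := by exact_mod_cast htr
  subst hsr
  exact ⟨hs, hCHH⟩

theorem qrank_conjTranspose_mul_self (B : Matrix (Fin n) (Fin n) ℍ[ℝ]) :
    qrank (Bᴴ * B) = qrank B := by
  have hker : LinearMap.ker (colLin (Bᴴ * B)) = LinearMap.ker (colLin B) := by
    ext v
    simp only [LinearMap.mem_ker, colLin_apply]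
    constructor
    · intro h
      -- The vector `v` is viewed as a square matrix with all columns equal to `v`.
      have h1 : Bᴴ * B * Matrix.of (fun x (_ : Fin n) => v x) = 0 := by
        ext1 x y
        exact congrFun h x
      have h2 := mul_eq_zero_of_conjTranspose_mul h1
      ext1 x
      exact congrFun (congrFun h2 x) x
    · intro h
      rw [← Matrix.mulVec_mulVec, h, Matrix.mulVec_zero]
  have h1 := qrank_add_finrank_ker (Bᴴ * B)
  have h2 := qrank_add_finrank_ker B
  rw [hker] at h1
  omega

end Hermitian

/-! ### The Drazin inverse -/

section Drazin

variable {n : ℕ}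

/-- If left multiplication by `C` does not lower the rank of `A`, it does not enlarge the
annihilator of `A`. -/
theorem mul_eq_zero_of_qrank_mul_eq {A C X : Matrix (Fin n) (Fin n) ℍ[ℝ]}
    (h : qrank (C * A) = qrank A) (hX : C * A * X = 0) : A * X = 0 := by
  have hle : LinearMap.ker (colLin A) ≤ LinearMap.ker (colLin (C * A)) := by
    intro v hv
    rw [LinearMap.mem_ker, colLin_apply] at hv ⊢
    rw [← Matrix.mulVec_mulVec, hv, Matrix.mulVec_zero]
  have h1 := qrank_add_finrank_ker A
  have h2 := qrank_add_finrank_ker (C * A)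
  have heq := Submodule.eq_of_le_of_finrank_eq hle (by omega)
  ext1 x y
  have hy : X.col y ∈ LinearMap.ker (colLin (C * A)) := by
    rw [LinearMap.mem_ker, colLin_apply]
    ext1 z
    exact congrFun (congrFun hX z) y
  rw [← heq, LinearMap.mem_ker, colLin_apply] at hy
  exact congrFun hy x

theorem exists_pow_eq_pow_mul {A : Matrix (Fin n) (Fin n) ℍ[ℝ]} {k : ℕ}
    (h : qrank (A ^ (k + 1)) = qrank (A ^ k)) (m : ℕ) : ∃ U, A ^ k = A ^ (k + m) * U := by
  have hle : LinearMap.range (colLin (A ^ (k + 1))) ≤ LinearMap.range (colLin (A ^ k)) := by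
    rw [pow_succ]
    exact range_colLin_mul_le _ _
  have heq := Submodule.eq_of_le_of_finrank_eq hle (by rwa [← qrank_eq, ← qrank_eq])
  obtain ⟨U, hU⟩ := exists_eq_mul_of_range_le heq.ge
  refine ⟨U ^ m, ?_⟩
  induction m with
  | zero => simp
  | succ m ih =>
    rw [pow_succ' U, ← Matrix.mul_assoc, show k + (m + 1) = m + (k + 1) by ring, pow_add A m,
      Matrix.mul_assoc _ _ U, ← hU, ← pow_add, add_comm m, ← ih]

theorem qrank_pow_add {A : Matrix (Fin n) (Fin n) ℍ[ℝ]} {k : ℕ}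
    (h : qrank (A ^ (k + 1)) = qrank (A ^ k)) (m : ℕ) : qrank (A ^ (k + m)) = qrank (A ^ k) := by
  obtain ⟨U, hU⟩ := exists_pow_eq_pow_mul h m
  rw [qrank_eq, qrank_eq]
  have h1 : LinearMap.range (colLin (A ^ (k + m))) ≤ LinearMap.range (colLin (A ^ k)) := by
    rw [pow_add]
    exact range_colLin_mul_le _ _
  have h2 : LinearMap.range (colLin (A ^ k)) ≤ LinearMap.range (colLin (A ^ (k + m))) := by
    rw [hU]
    exact range_colLin_mul_le _ _
  rw [le_antisymm h1 h2]

/-- The matrix `(adjSum r (Bᴴ * B) * Bᴴ) / d` is a generalized inverse of `B`. -/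
theorem mul_adjSum_mul {B : Matrix (Fin n) (Fin n) ℍ[ℝ]} {r : ℕ} (hr : qrank B = r) :
    B * (adjSum r (Bᴴ * B) * (Bᴴ * B)) = realMinorSum r (Bᴴ * B) • B := by
  have hH : (Bᴴ * B).IsHermitian := Matrix.isHermitian_conjTranspose_mul_self B
  obtain ⟨-, h2⟩ := adjSum_qrank hH ((qrank_conjTranspose_mul_self B).trans hr)
  have h3 : Bᴴ * B * (adjSum r (Bᴴ * B) * (Bᴴ * B) - realMinorSum r (Bᴴ * B) • 1) = 0 := by
    rw [Matrix.mul_sub, ← Matrix.mul_assoc, commute_adjSum hH, h2, Matrix.mul_smul,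
      Matrix.mul_one, sub_self]
  have h4 := mul_eq_zero_of_conjTranspose_mul h3
  rwa [Matrix.mul_sub, Matrix.mul_smul, Matrix.mul_one, sub_eq_zero] at h4

/-- Powers of `A` from the index on have the same kernel, so the idempotent that belongs to
`B = A ^ (k + m)` acts as a right unit on `A ^ k` too. -/
theorem pow_mul_adjSum_mul {A : Matrix (Fin n) (Fin n) ℍ[ℝ]} {k r m : ℕ}
    (h : qrank (A ^ (k + 1)) = qrank (A ^ k)) (hr : qrank (A ^ k) = r)
    {B : Matrix (Fin n) (Fin n) ℍ[ℝ]} (hB : B = A ^ (k + m)) :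
    A ^ k * (adjSum r (Bᴴ * B) * (Bᴴ * B)) = realMinorSum r (Bᴴ * B) • A ^ k := by
  have hq := qrank_pow_add h m
  have h1 := mul_adjSum_mul (B := B) (r := r) (by rw [hB, hq, hr])
  have h2 : B = A ^ m * A ^ k := by rw [hB, ← pow_add, add_comm]
  have h3 : A ^ k * (adjSum r (Bᴴ * B) * (Bᴴ * B) - realMinorSum r (Bᴴ * B) • 1) = 0 := by
    apply mul_eq_zero_of_qrank_mul_eq (C := A ^ m)
    · rw [← pow_add, add_comm, hq]
    · rw [← h2, Matrix.mul_sub, Matrix.mul_smul, Matrix.mul_one, h1, sub_self]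
  rwa [Matrix.mul_sub, Matrix.mul_smul, Matrix.mul_one, sub_eq_zero] at h3

theorem exists_isDrazinInverse {A : Matrix (Fin n) (Fin n) ℍ[ℝ]} {k : ℕ}
    (h : qrank (A ^ (k + 1)) = qrank (A ^ k)) : ∃ D, IsDrazinInverse A k D := by
  -- With `A ^ k = A ^ (2 * k + 1) * U = V * A ^ (2 * k + 1)`, the Drazin inverse is
  -- `V * A ^ (2 * k + 1) * U = A ^ k * U = V * A ^ k`.
  obtain ⟨U, hU⟩ := exists_pow_eq_pow_mul h (k + 1)
  obtain ⟨V, hV⟩ : ∃ V, A ^ k = V * A ^ (k + (k + 1)) := by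
    set B := A ^ (k + (k + 1)) with hB
    have h1 := pow_mul_adjSum_mul h rfl hB
    have hd := (adjSum_qrank (Matrix.isHermitian_conjTranspose_mul_self B)
      ((qrank_conjTranspose_mul_self B).trans (qrank_pow_add h (k + 1)))).1
    refine ⟨(realMinorSum (qrank (A ^ k)) (Bᴴ * B))⁻¹ •
      (A ^ k * (adjSum (qrank (A ^ k)) (Bᴴ * B) * Bᴴ)), ?_⟩
    rw [Matrix.smul_mul, Matrix.mul_assoc, Matrix.mul_assoc (adjSum _ _), h1, smul_smul,
      inv_mul_cancel₀ hd, one_smul]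
  have hUV : A ^ k * U = V * A ^ k := by
    conv_lhs => rw [hV]
    rw [Matrix.mul_assoc, ← hU]
  have hDA : A ^ k * U * A = A ^ (k + 1) * U := by
    calc A ^ k * U * A = V * (A * A ^ k) := by rw [hUV, Matrix.mul_assoc, ← pow_succ, pow_succ']
      _ = V * (A * A ^ (k + (k + 1)) * U) := by rw [Matrix.mul_assoc A, ← hU]
      _ = V * A ^ (k + (k + 1)) * A * U := by
        rw [← pow_succ', pow_succ]
        simp only [Matrix.mul_assoc]
      _ = A ^ (k + 1) * U := by rw [← hV, ← pow_succ]
  refine ⟨A ^ k * U, ?_, ?_, ?_⟩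
  · calc A ^ k * U * A * (A ^ k * U) = V * A ^ k * A * (A ^ k * U) := by rw [hUV]
      _ = V * (A ^ k * (A * A ^ k)) * U := by simp only [Matrix.mul_assoc]
      _ = A ^ k * U := by rw [← pow_succ', ← pow_add, ← hV]
  · rw [hDA, ← Matrix.mul_assoc, ← pow_succ']
  · rw [← Matrix.mul_assoc, ← pow_add, add_comm (k + 1), ← hU]

theorem IsDrazinInverse.mul_mul_self {A D : Matrix (Fin n) (Fin n) ℍ[ℝ]} {k : ℕ}
    (hD : IsDrazinInverse A k D) : A * D * D = D := by
  rw [hD.2.1, hD.1]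

theorem IsDrazinInverse.pow_mul_pow {A D : Matrix (Fin n) (Fin n) ℍ[ℝ]} {k : ℕ}
    (hD : IsDrazinInverse A k D) (m : ℕ) : A ^ m * D ^ (m + 1) = D := by
  induction m with
  | zero => simp
  | succ m ih =>
    rw [pow_succ A, pow_succ' D (m + 1), pow_succ' D m, Matrix.mul_assoc, ← Matrix.mul_assoc D,
      ← Matrix.mul_assoc A, ← Matrix.mul_assoc A, hD.mul_mul_self, ← pow_succ', ih]

theorem IsDrazinInverse.pow_add_mul_pow {A D : Matrix (Fin n) (Fin n) ℍ[ℝ]} {k : ℕ}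
    (hD : IsDrazinInverse A k D) (m : ℕ) : A ^ (k + m) * D ^ m = A ^ k := by
  induction m with
  | zero => simp
  | succ m ih =>
    rw [show k + (m + 1) = m + (k + 1) by ring, pow_add, pow_succ' D, Matrix.mul_assoc,
      ← Matrix.mul_assoc _ D, hD.2.2, ← Matrix.mul_assoc, ← pow_add, add_comm m, ih]

theorem IsDrazinInverse.commute {A D : Matrix (Fin n) (Fin n) ℍ[ℝ]} {k : ℕ}
    (hD : IsDrazinInverse A k D) : Commute A D := hD.2.1

theorem IsDrazinInverse.unique {A X Y : Matrix (Fin n) (Fin n) ℍ[ℝ]} {k : ℕ}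
    (hX : IsDrazinInverse A k X) (hY : IsDrazinInverse A k Y) : X = Y := by
  have hX' : X ^ (k + 1) * A ^ k = X := by
    rw [← (hX.commute.pow_pow k (k + 1)).eq, hX.pow_mul_pow]
  have h1 : X = X * A * Y := by
    conv_lhs => rw [← hX', ← hY.2.2]
    conv_rhs => rw [← hX']
    rw [pow_succ A]
    simp only [Matrix.mul_assoc]
  have h2 : Y = X * A * Y := by
    conv_lhs => rw [← hY.pow_mul_pow k, ← hX.2.2, ← (hX.commute.pow_left (k + 1)).eq.symm]
    conv_rhs => rw [← hY.pow_mul_pow k]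
    rw [pow_succ' A]
    simp only [Matrix.mul_assoc]
  rw [h1, ← h2]

/-- The determinantal representation of the Drazin inverse of a Hermitian matrix. -/
theorem IsDrazinInverse.adjSum_mul_pow {A D : Matrix (Fin n) (Fin n) ℍ[ℝ]} {k r : ℕ}
    (hD : IsDrazinInverse A k D) (hA : A.IsHermitian) (hr : qrank (A ^ (k + 1)) = r) (m : ℕ) :
    adjSum r (A ^ (k + 1)) * A ^ (k + m) = realMinorSum r (A ^ (k + 1)) • (D * A ^ m) := by
  obtain ⟨-, h⟩ := adjSum_qrank (hA.pow (k + 1)) hr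
  have h1 : A ^ (k + m) = A ^ (k + 1) * (A ^ (k + 1) * D ^ (k + 2)) * A ^ m := by
    rw [hD.pow_mul_pow (k + 1), hD.2.2, pow_add]
  rw [h1, ← Matrix.mul_assoc, ← Matrix.mul_assoc, ← Matrix.mul_assoc, h, Matrix.smul_mul,
    Matrix.smul_mul, hD.pow_mul_pow (k + 1)]

/-- The determinantal representation of the Drazin inverse of an arbitrary matrix. -/
theorem IsDrazinInverse.pow_mul_adjSum_mul_pow {A D : Matrix (Fin n) (Fin n) ℍ[ℝ]} {k r : ℕ}
    (hD : IsDrazinInverse A k D) (h : qrank (A ^ (k + 1)) = qrank (A ^ k))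
    (hr : qrank (A ^ k) = r) {B : Matrix (Fin n) (Fin n) ℍ[ℝ]} (hB : B = A ^ (2 * k + 1)) (m : ℕ) :
    A ^ k * (adjSum r (Bᴴ * B) * (Bᴴ * A ^ (k + m))) =
      realMinorSum r (Bᴴ * B) • (D * A ^ m) := by
  have hB' : B = A ^ (k + (k + 1)) := by rw [hB]; congr 1; ring
  have h1 : A ^ (k + m) = B * (D ^ (k + 1) * A ^ m) := by
    rw [← Matrix.mul_assoc, hB', hD.pow_add_mul_pow, pow_add]
  rw [h1, ← Matrix.mul_assoc Bᴴ, ← Matrix.mul_assoc (adjSum _ _), ← Matrix.mul_assoc (A ^ k),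
    pow_mul_adjSum_mul h hr hB', Matrix.smul_mul, ← Matrix.mul_assoc, hD.pow_mul_pow]

end Drazin

/-! ### The differential equation -/

section Solution

variable {n : ℕ}

theorem hasDerivAt_partialSol {A D : Matrix (Fin n) (Fin n) ℍ[ℝ]} {k : ℕ}
    (hD : IsDrazinInverse A k D) (b : Fin n → ℍ[ℝ]) (t : ℝ) :
    HasDerivAt (partialSol A D b k) (A *ᵥ partialSol A D b k t + b) t := by
  -- `c m` is the coefficient of `t ^ m / m!`; the sequence satisfies `A c_m = c_(m+1)`,
  -- and `c_(k+1) = 0` since `D * A ^ (k + 1) = A ^ k`.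
  set c : ℕ → Fin n → ℍ[ℝ] := fun m => (A ^ m) *ᵥ b - (D * A ^ (m + 1)) *ᵥ b with hc
  have hAc : ∀ m, A *ᵥ c m = c (m + 1) := by
    intro m
    simp only [hc]
    rw [Matrix.mulVec_sub, Matrix.mulVec_mulVec, Matrix.mulVec_mulVec, ← pow_succ',
      ← Matrix.mul_assoc, hD.2.1, Matrix.mul_assoc, ← pow_succ']
  have hck : c k = 0 := by
    simp only [hc]
    rw [← (hD.commute.pow_left (k + 1)).eq, hD.2.2, sub_self]
  have hsol : partialSol A D b k = fun t : ℝ => -(D *ᵥ b) +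
      ∑ j ∈ Finset.range k, (t ^ (j + 1) / ((j + 1).factorial : ℝ)) • c j := by
    funext t
    have h := Finset.sum_Ico_add' (fun m : ℕ =>
      (t ^ m / (m.factorial : ℝ)) • ((A ^ (m - 1)) *ᵥ b - (D * A ^ m) *ᵥ b)) 0 k 1
    rw [Finset.range_eq_Ico]
    exact congrArg (-(D *ᵥ b) + ·) h.symm
  have hder : HasDerivAt (partialSol A D b k)
      (∑ j ∈ Finset.range k, (t ^ j / (j.factorial : ℝ)) • c j) t := by
    rw [hsol]
    apply HasDerivAt.const_add
    apply HasDerivAt.fun_sum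
    intro j _
    apply HasDerivAt.smul_const
    have h := (hasDerivAt_pow (j + 1) t).div_const ((j + 1).factorial : ℝ)
    convert h using 1
    have h1 : (j.factorial : ℝ) ≠ 0 := by exact_mod_cast j.factorial_ne_zero
    rw [Nat.factorial_succ, Nat.add_sub_cancel]
    push_cast
    field_simp
  convert hder using 1
  have h0 : -((A * D) *ᵥ b) + b = c 0 := by
    simp only [hc]
    rw [pow_zero, Matrix.one_mulVec, zero_add, pow_one, hD.2.1]
    abel
  have hlast := Finset.sum_range_succ (fun j => (t ^ j / (j.factorial : ℝ)) • c j) k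
  rw [hck, smul_zero, add_zero, Finset.sum_range_succ'] at hlast
  rw [hsol, ← hlast]
  simp only [Matrix.mulVec_add, Matrix.mulVec_neg, Matrix.mulVec_mulVec, Matrix.mulVec_sum,
    Matrix.mulVec_smul, hAc, pow_zero, Nat.factorial_zero, Nat.cast_one, div_one, one_smul, ← h0]
  abel

end Solution

end QuatLin

theorem theorem3p16 (n : ℕ) (A : Matrix (Fin n) (Fin n) ℍ[ℝ]) (b : Fin n → ℍ[ℝ]) (k r : ℕ)
    (hk : HasIndex A k) (hr : qrank (A ^ k) = r) :
    ∃ D : Matrix (Fin n) (Fin n) ℍ[ℝ],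
      -- `D` is the Drazin inverse of `A`
      (IsDrazinInverse A k D ∧ ∀ X, IsDrazinInverse A k X → X = D) ∧
      -- `partialSol A D b k` solves `x' = A x + b`
      (∀ t : ℝ, HasDerivAt (partialSol A D b k) (A *ᵥ partialSol A D b k t + b) t) ∧
      -- (i) `A` Hermitian
      (A.IsHermitian →
        minorSum r (A ^ (k + 1)) ≠ 0 ∧
        ∀ (t : ℝ) (i : Fin n),
          partialSol A D b k t i =
            -(cdetSum r (A ^ (k + 1)) i ((A ^ k) *ᵥ b) / minorSum r (A ^ (k + 1))) +
            ∑ m ∈ Finset.Icc 1 k, (t ^ m / (m.factorial : ℝ)) •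
              (((A ^ (m - 1)) *ᵥ b) i -
                cdetSum r (A ^ (k + 1)) i ((A ^ (k + m)) *ᵥ b) / minorSum r (A ^ (k + 1)))) ∧
      -- (ii) `A` arbitrary
      (minorSum r ((A ^ (2 * k + 1))ᴴ * A ^ (2 * k + 1)) ≠ 0 ∧
        ∀ (t : ℝ) (i : Fin n),
          partialSol A D b k t i =
            -((∑ s : Fin n, (A ^ k) i s *
                cdetSum r ((A ^ (2 * k + 1))ᴴ * A ^ (2 * k + 1)) s
                  (((A ^ (2 * k + 1))ᴴ * A ^ k) *ᵥ b)) /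
              minorSum r ((A ^ (2 * k + 1))ᴴ * A ^ (2 * k + 1))) +
            ∑ m ∈ Finset.Icc 1 k, (t ^ m / (m.factorial : ℝ)) •
              (((A ^ (m - 1)) *ᵥ b) i -
                (∑ s : Fin n, (A ^ k) i s *
                  cdetSum r ((A ^ (2 * k + 1))ᴴ * A ^ (2 * k + 1)) s
                    (((A ^ (2 * k + 1))ᴴ * A ^ (k + m)) *ᵥ b)) /
                minorSum r ((A ^ (2 * k + 1))ᴴ * A ^ (2 * k + 1)))) := by
  have hidx : qrank (A ^ (k + 1)) = qrank (A ^ k) := hk.1.2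
  obtain ⟨D, hD⟩ := exists_isDrazinInverse hidx
  -- An identity `(D * A ^ m) b = y m / δ` for all `m` turns `partialSol` into the asserted form.
  have key : ∀ (i : Fin n) (δ : ℍ[ℝ]) (y : ℕ → ℍ[ℝ]),
      (∀ m, ((D * A ^ m) *ᵥ b) i = y m / δ) → ∀ t : ℝ,
      partialSol A D b k t i = -(y 0 / δ) + ∑ m ∈ Finset.Icc 1 k, (t ^ m / (m.factorial : ℝ)) •
        (((A ^ (m - 1)) *ᵥ b) i - y m / δ) := by
    intro i δ y hy t
    have h0 := hy 0
    rw [pow_zero, Matrix.mul_one] at h0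
    simp only [partialSol, Pi.add_apply, Pi.neg_apply, Finset.sum_apply, Pi.smul_apply,
      Pi.sub_apply, hy, h0]
  have hdiv : ∀ {d : ℝ} {x y : ℍ[ℝ]}, d ≠ 0 → y = d • x → x = y / (d : ℍ[ℝ]) := by
    intro d x y hd h
    have hd' : (d : ℍ[ℝ]) ≠ 0 := fun h => hd (Quaternion.coe_injective h)
    rw [h, ← Quaternion.coe_mul_eq_smul, Quaternion.coe_commutes, mul_div_cancel_right₀ _ hd']
  refine ⟨D, ⟨hD, fun X hX => hX.unique hD⟩, hasDerivAt_partialSol hD b, fun hA => ?_, ?_⟩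
  · have hH := hA.pow (k + 1)
    have hd := (adjSum_qrank hH (hidx.trans hr)).1
    rw [minorSum_eq hH]
    refine ⟨fun h => hd (Quaternion.coe_injective h), fun t i => ?_⟩
    refine key i _ (fun m => cdetSum r (A ^ (k + 1)) i ((A ^ (k + m)) *ᵥ b)) (fun m => ?_) t
    apply hdiv hd
    rw [← adjSum_mulVec hH, Matrix.mulVec_mulVec, hD.adjSum_mul_pow hA (hidx.trans hr),
      Matrix.smul_mulVec]
    rfl
  · set B := A ^ (2 * k + 1) with hB
    have hH : (Bᴴ * B).IsHermitian := Matrix.isHermitian_conjTranspose_mul_self B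
    have hrB : qrank B = r := by
      rw [hB, show 2 * k + 1 = k + (k + 1) by ring, qrank_pow_add hidx, hr]
    have hd := (adjSum_qrank hH ((qrank_conjTranspose_mul_self B).trans hrB)).1
    rw [minorSum_eq hH]
    refine ⟨fun h => hd (Quaternion.coe_injective h), fun t i => ?_⟩
    refine key i _ (fun m => ∑ s : Fin n, (A ^ k) i s *
      cdetSum r (Bᴴ * B) s ((Bᴴ * A ^ (k + m)) *ᵥ b)) (fun m => ?_) t
    apply hdiv hd
    simp only [← adjSum_mulVec hH, Matrix.mulVec_mulVec]
    change ((A ^ k) *ᵥ ((adjSum r (Bᴴ * B) * (Bᴴ * A ^ (k + m))) *ᵥ b)) i = _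
    rw [Matrix.mulVec_mulVec, hD.pow_mul_adjSum_mul_pow hidx hr hB, Matrix.smul_mulVec]
    rfl
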